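/- Let $\mathcal X$ be a separable topological space with its Borel $\sigma$-field, $K:\mathcal X\times\mathcal X\to\mathbb R$ a continuous reproducing kernel with reproducing kernel Hilbert space $\mathcal H_K$, and $B_K=\{f\in\mathcal H_K:\|f\|_K\le 1\}$. Let $\mathbb P,\mathbb Q$ be Borel probability measures on $\mathcal X$ with $\int K(x,x)\,d\mathbb P(x)<\infty$ and $\int K(x,x)\,d\mathbb Q(x)<\infty$. Write $\mu_{\mathbb P}=\int K(\cdot,x)\,d\mathbb P(x)\in\mathcal H_K$ for the mean embedding, $\Sigma_{\mathbb P}=\int (K(\cdot,x)-\mu_{\mathbb P})\otimes(K(\cdot,x)-\mu_{\mathbb P})\,d\mathbb P(x)$ for the covariance operator (both Bochner integrals; similarly $\mu_{\mathbb Q},\Sigma_{\mathbb Q}$), and $\mathrm{MMD}(\mathbb P,\mathbb Q)=\|\mu_{\mathbb P}-\mu_{\mathbb Q}\|_K$. Assume that $\Sigma_{\mathbb P}$ and $\Sigma_{\mathbb Q}$ are trace-class. Let $x_1,\dots,x_N\sim\mathbb P$ and $y_1,\dots,y_N\sim\mathbb Q$ be $2N$ independent random variables. Let $(x'_n,y'_n)_{n\le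 N}$ be the observed sample, obtained from $(x_n,y_n)_{n\le N}$ by arbitrarily corrupting at most $N_c$ of the $N$ pairs. Let $\delta\in(0,1/2]$ and $\eta\in(0,1)$ be such that $Q=72\,\delta^{-2}\ln(1/\eta)$ is an integer that divides $N$, with $N_c\le Q(1/2-\delta)$ and $Q<N/2$. Let $S_1,\dots,S_Q$ be a partition of $\{1,\dots,N\}$ into blocks of equal cardinality $N/Q$, and let $$\widehat{\mathrm{MMD}}_Q(\mathbb P,\mathbb Q)=\sup_{f\in B_K}\ \operatorname*{med}_{1\le q\le Q}\Big\{\Big\langle f,\ \tfrac{1}{|S_q|}\sum_{n\in S_q}K(\cdot,x'_n)-\tfrac1{|S_q|}\sum_{n\in S_q}K(\cdot,y'_n)\Big\rangle_K\Big\},$$ where the median of an even number of values is the average of the two middle ones. Then, with probability at least $1-\eta$, $$\big|\widehat{\mathrm{MMD}}_Q(\mathbb P,\mathbb Q)-\mathrm{MMD}(\mathbb P,\mathbb Q)\big|\le\frac{12}{\delta}\max\left(\sqrt{\frac{(\|\Sigma_{\mathbb P}\|+\|\Sigma_{\mathbb Q}\|)\ln(1/\eta)}{\delta N}},\ 2\sqrt{\frac{\operatorname{Tr}(\Sigma_{\mathbb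 P})+\operatorname{Tr}(\Sigma_{\mathbb Q})}{N}}\right).$$ -/

import Mathlib

open MeasureTheory ProbabilityTheory
open scoped InnerProductSpace

namespace MONK

noncomputable section

section Operator

variable {H : Type*} [NormedAddCommGroup H] [InnerProductSpace ℝ H] [CompleteSpace H]

/-- The index set of a fixed (arbitrarily chosen) orthonormal basis of the Hilbert space `H`. -/
def onbIndex (H : Type*) [NormedAddCommGroup H] [InnerProductSpace ℝ H] [CompleteSpace H] :
    Set H :=
  (exists_hilbertBasis ℝ H).choose

/-- A fixed (arbitrarily chosen) orthonormal basis of the Hilbert space `H`. -/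
def onb (H : Type*) [NormedAddCommGroup H] [InnerProductSpace ℝ H] [CompleteSpace H] :
    HilbertBasis (onbIndex H) ℝ H :=
  (exists_hilbertBasis ℝ H).choose_spec.choose

/-- `A` is trace-class: `∑ i, ⟪(A* A)^{1/2} e i, e i⟫ < ∞`, where `(A* A)^{1/2}` is the (unique)
non-negative self-adjoint bounded operator whose square is `A* A`. -/
def IsTraceClass (A : H →L[ℝ] H) : Prop :=
  ∃ B : H →L[ℝ] H, B.IsPositive ∧ B ∘L B = (ContinuousLinearMap.adjoint A) ∘L A ∧
    Summable fun i => ⟪B (onb H i), onb H i⟫_ℝ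

/-- The trace `Tr A = ∑ i, ⟪A e i, e i⟫` of a (trace-class) operator. -/
def trace (A : H →L[ℝ] H) : ℝ :=
  ∑' i, ⟪A (onb H i), onb H i⟫_ℝ

end Operator

/-- The median of the numbers `z 0, …, z (n - 1)`: the middle one in increasing order when `n` is
odd, the average of the two middle ones when `n` is even (and `0` when `n = 0`). -/
def median {n : ℕ} (z : Fin n → ℝ) : ℝ :=
  if h : 0 < n then
    (z (Tuple.sort z ⟨(n - 1) / 2, by omega⟩) + z (Tuple.sort z ⟨n / 2, by omega⟩)) / 2
  else 0

section Kernel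

variable {𝒳 : Type*} (H : Type*) [NormedAddCommGroup H] [InnerProductSpace ℝ H]
  [CompleteSpace H] [RKHS ℝ H 𝒳 ℝ]

/-- The canonical feature `K(·, x)` of the point `x`, as an element of the reproducing kernel
Hilbert space `H`. -/
def feature (x : 𝒳) : H := RKHS.kerFun H x 1

/-- The (real-valued) reproducing kernel of `H`. -/
def kernelFn (x y : 𝒳) : ℝ := RKHS.kernel H x y 1

/-- The mean embedding `∫ K(·, x) dP(x)` (a Bochner integral in `H`). -/
def meanEmbedding [MeasurableSpace 𝒳] (P : Measure 𝒳) : H := ∫ x, feature H x ∂P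

/-- The covariance operator `∫ (K(·, x) - μ_P) ⊗ (K(·, x) - μ_P) dP(x)` (a Bochner integral),
where `(a ⊗ b) c = ⟪b, c⟫ a`. -/
def covOp [MeasurableSpace 𝒳] (P : Measure 𝒳) : H →L[ℝ] H :=
  ∫ x, InnerProductSpace.rankOne ℝ
    (feature H x - meanEmbedding H P) (feature H x - meanEmbedding H P) ∂P

/-- The maximum mean discrepancy of `P` and `R`. -/
def MMD [MeasurableSpace 𝒳] (P R : Measure 𝒳) : ℝ := ‖meanEmbedding H P - meanEmbedding H R‖

/-- The mean embedding `|S|⁻¹ ∑ i ∈ S, K(·, x i)` of the empirical measure of `(x i), i ∈ S`. -/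
def blockMean {N : ℕ} (x : Fin N → 𝒳) (S : Finset (Fin N)) : H :=
  (S.card : ℝ)⁻¹ • ∑ i ∈ S, feature H (x i)

/-- The median-of-means (MONK) estimator of the maximum mean discrepancy computed from the two
samples `x`, `y` with blocks `S q`: the supremum over the closed unit ball of `H` of the median
over the blocks of `⟪f, μ_{S q, x} - μ_{S q, y}⟫`. -/
def mmdEstimator {N Q : ℕ} (S : Fin Q → Finset (Fin N)) (x y : Fin N → 𝒳) : ℝ :=
  ⨆ f : Metric.closedBall (0 : H) 1,
    median fun q => ⟪(f : H), blockMean H x (S q) - blockMean H y (S q)⟫_ℝ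

end Kernel

end

end MONK

/-! Fix the radius `r` of the bound. The median of `⟪f, ·⟫` over blocks is within `r` of `⟪f, μP -
μR⟫` once fewer than half of the blocks deviate by more than `r` in direction `f`, and likewise for
`-f`; taking suprema over the unit ball then gives the claim (`abs_iSup_median_sub_norm_le`). At
most `Nc ≤ Q * (1/2 - δ)` blocks meet a corrupted pair, so it suffices that, with probability `1 -
η`, fewer than `δ * Q` clean blocks deviate, simultaneously for all `f`
(`exists_measurableSet_card_lt`).

To count deviating blocks, replace the indicator of `(r, ∞)` by the Lipschitz majorant `ramp r`. Its
mean on a block is at most `δ/2` by Chebyshev, where the operator norms of the covariances enter.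
The supremum over `f` of the centered sum has mean at most `Q * δ / 6`, by symmetrization and
contraction (`integral_ballSup_le`), where the traces enter. By McDiarmid's inequality it exceeds
its mean by `Q * δ / 12` with probability at most `exp (-Q * δ ^ 2 / 72) = η`. The total is `3/4 * δ
* Q`. -/

namespace MONK

/-! ### McDiarmid's bounded differences inequality. -/

section BoundedDifferences

variable {α : Type*} [MeasurableSpace α]

lemma integral_pi_succ {E : Type*} [NormedAddCommGroup E] [NormedSpace ℝ E] {n : ℕ}
    (ν : Fin (n + 1) → Measure α) [∀ i, IsProbabilityMeasure (ν i)]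
    (F : (Fin (n + 1) → α) → E) :
    ∫ x, F x ∂(Measure.pi ν) =
      ∫ p, F (Fin.cons p.1 p.2) ∂((ν 0).prod (Measure.pi fun i : Fin n => ν i.succ)) := by
  have := (measurePreserving_piFinSuccAbove ν 0).symm
  rw [← this.integral_comp']
  simp [MeasurableEquiv.piFinSuccAbove_symm_apply, Fin.insertNthEquiv]

lemma measurable_finCons {n : ℕ} :
    Measurable fun p : α × (Fin n → α) => (Fin.cons p.1 p.2 : Fin (n + 1) → α) := by
  refine measurable_pi_iff.2 fun i => ?_
  refine Fin.cases ?_ (fun j => ?_) i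
  · simpa using measurable_fst
  · simpa using! (measurable_pi_apply j).comp measurable_snd

lemma integrable_of_abs_le {β : Type*} [MeasurableSpace β] {μ : Measure β} [IsFiniteMeasure μ]
    {f : β → ℝ} (hf : Measurable f) {C : ℝ} (hC : ∀ x, |f x| ≤ C) : Integrable f μ :=
  Integrable.of_bound hf.aestronglyMeasurable C (ae_of_all _ hC)

/-- The exponential moment bound behind McDiarmid's bounded differences inequality. -/
lemma integral_exp_le_of_bounded_differences {n : ℕ} (ν : Fin n → Measure α)
    [∀ i, IsProbabilityMeasure (ν i)] (F : (Fin n → α) → ℝ) (hF : Measurable F) {C : ℝ}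
    (hC : ∀ x, |F x| ≤ C) (hd : ∀ i x y, (∀ j, j ≠ i → x j = y j) → F x - F y ≤ 1) (t : ℝ) :
    ∫ x, Real.exp (t * F x) ∂(Measure.pi ν) ≤
      Real.exp (t * ∫ x, F x ∂(Measure.pi ν) + n * t ^ 2 / 8) := by
  induction n with
  | zero =>
    have hF0 : F = fun _ => F default := funext fun x => congrArg F (Subsingleton.elim _ _)
    rw [hF0]
    simp
  | succ n ih =>
    have hF' : Measurable fun p : α × (Fin n → α) => F (Fin.cons p.1 p.2) :=
      hF.comp measurable_finCons
    have hexp : ∀ p : α × (Fin n → α), |Real.exp (t * F (Fin.cons p.1 p.2))| ≤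
        Real.exp (|t| * C) := fun p => by
      rw [abs_of_pos (Real.exp_pos _)]
      refine Real.exp_le_exp.2 ((le_abs_self _).trans ?_)
      rw [abs_mul]
      exact mul_le_mul_of_nonneg_left (hC _) (abs_nonneg _)
    rw [integral_pi_succ, integral_pi_succ,
      integral_prod _ (integrable_of_abs_le (hF'.const_mul t).exp hexp),
      integral_prod _ (integrable_of_abs_le hF' fun p => hC _)]
    -- `g` averages `F` over all coordinates but the first and still oscillates by at most one.
    -- Induction bounds the inner integral; Hoeffding's lemma for `g` supplies one more factor `exp
    -- (t ^ 2 / 8)`.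
    set π := Measure.pi fun i : Fin n => ν i.succ
    set g : α → ℝ := fun a => ∫ y, F (Fin.cons a y) ∂π with hg
    have hgm : Measurable g := (hF'.stronglyMeasurable.integral_prod_right').measurable
    have hint : ∀ a, Integrable (fun y => F (Fin.cons a y)) π := fun a =>
      integrable_of_abs_le (hF'.comp measurable_prodMk_left) fun y => hC _
    have hgC : ∀ a, |g a| ≤ C := fun a => by
      have := norm_integral_le_of_norm_le_const (μ := π) (f := fun y => F (Fin.cons a y))
        (ae_of_all _ fun y => hC _)
      simpa using this
    have hg1 : ∀ a b, g a - g b ≤ 1 := fun a b => by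
      rw [hg, ← integral_sub (hint a) (hint b)]
      calc _ ≤ ∫ y, (1 : ℝ) ∂π := by
            refine integral_mono ((hint a).sub (hint b)) (integrable_const _) fun y => ?_
            refine hd 0 _ _ fun j hj => ?_
            obtain ⟨k, rfl⟩ := Fin.exists_succ_eq.2 hj
            simp
        _ = 1 := by simp
    have step : ∀ a, ∫ y, Real.exp (t * F (Fin.cons a y)) ∂π ≤
        Real.exp (t * g a + n * t ^ 2 / 8) := fun a => by
      refine ih _ _ (hF'.comp measurable_prodMk_left) (fun y => hC _) fun i x y hxy => ?_
      refine hd i.succ _ _ fun j => ?_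
      refine Fin.cases (by simp) (fun k hk => ?_) j
      simpa using hxy k fun h => hk (by rw [h])
    have : Nonempty α := (ν 0).nonempty_of_neZero
    have hbdd : BddBelow (Set.range g) := ⟨-C, by rintro _ ⟨a, rfl⟩; exact (abs_le.1 (hgC a)).1⟩
    have hmem : ∀ a, g a ∈ Set.Icc (⨅ a, g a) ((⨅ a, g a) + 1) := fun a =>
      ⟨ciInf_le hbdd a, by
        have : g a - 1 ≤ ⨅ b, g b := le_ciInf fun b => by linarith [hg1 a b]
        linarith⟩
    have hsub := (hasSubgaussianMGF_of_mem_Icc (μ := ν 0) hgm.aemeasurable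
      (ae_of_all _ hmem)).mgf_le t
    have hexpg : Integrable (fun a => Real.exp (t * g a)) (ν 0) := by
      refine integrable_of_abs_le (C := Real.exp (|t| * C)) (by fun_prop) fun a => ?_
      rw [abs_of_pos (Real.exp_pos _)]
      refine Real.exp_le_exp.2 ((le_abs_self _).trans ?_)
      rw [abs_mul]
      exact mul_le_mul_of_nonneg_left (hgC _) (abs_nonneg _)
    have hmgf : ∫ a, Real.exp (t * g a) ∂(ν 0) ≤
        Real.exp (t * ∫ a, g a ∂(ν 0) + t ^ 2 / 8) := by
      have e1 : ∀ a, Real.exp (t * g a) =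
          Real.exp (t * ∫ a, g a ∂(ν 0)) * Real.exp (t * (g a - ∫ a, g a ∂(ν 0))) := fun a => by
        rw [← Real.exp_add]; ring_nf
      simp_rw [e1]
      rw [integral_const_mul, Real.exp_add]
      refine mul_le_mul_of_nonneg_left (hsub.trans (le_of_eq ?_)) (Real.exp_pos _).le
      congr 1
      simp
      ring
    calc _ ≤ ∫ a, Real.exp (t * g a + n * t ^ 2 / 8) ∂(ν 0) := by
          refine integral_mono_of_nonneg (ae_of_all _ fun a => ?_) ?_ (ae_of_all _ step)
          · exact integral_nonneg fun y => (Real.exp_pos _).le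
          · simp_rw [Real.exp_add]; exact hexpg.mul_const _
      _ ≤ Real.exp (t * ∫ a, g a ∂(ν 0) + t ^ 2 / 8) * Real.exp (n * t ^ 2 / 8) := by
          simp_rw [Real.exp_add (t * g _)]
          rw [integral_mul_const]
          exact mul_le_mul_of_nonneg_right hmgf (Real.exp_pos _).le
      _ = _ := by
          rw [← Real.exp_add]; congr 1; push_cast; ring

/-- **McDiarmid's inequality** for product measures. -/
lemma measure_pi_ge_le_of_bounded_differences {n : ℕ} (hn : 0 < n) (ν : Fin n → Measure α)
    [∀ i, IsProbabilityMeasure (ν i)] (F : (Fin n → α) → ℝ) (hF : Measurable F) {C : ℝ}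
    (hC : ∀ x, |F x| ≤ C) (hd : ∀ i x y, (∀ j, j ≠ i → x j = y j) → F x - F y ≤ 1)
    {u : ℝ} (hu : 0 ≤ u) :
    (Measure.pi ν).real {x | ∫ y, F y ∂(Measure.pi ν) + u ≤ F x} ≤
      Real.exp (-2 * u ^ 2 / n) := by
  have hn' : (0 : ℝ) < n := by exact_mod_cast hn
  -- This `t` minimises the Chernoff exponent `-t * u + n * t ^ 2 / 8`.
  set t : ℝ := 4 * u / n with ht
  have ht0 : 0 ≤ t := by positivity
  have hint : Integrable (fun x => Real.exp (t * F x)) (Measure.pi ν) := by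
    refine integrable_of_abs_le (C := Real.exp (|t| * C)) (by fun_prop) fun a => ?_
    rw [abs_of_pos (Real.exp_pos _)]
    refine Real.exp_le_exp.2 ((le_abs_self _).trans ?_)
    rw [abs_mul]
    exact mul_le_mul_of_nonneg_left (hC _) (abs_nonneg _)
  refine (measure_ge_le_exp_mul_mgf _ ht0 hint).trans ?_
  calc _ ≤ Real.exp (-t * (∫ y, F y ∂(Measure.pi ν) + u)) *
        Real.exp (t * ∫ x, F x ∂(Measure.pi ν) + n * t ^ 2 / 8) :=
        mul_le_mul_of_nonneg_left (integral_exp_le_of_bounded_differences ν F hF hC hd t)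
          (Real.exp_pos _).le
    _ = _ := by
        rw [← Real.exp_add]
        congr 1
        rw [ht]
        field_simp
        ring

end BoundedDifferences

/-- A supremum of functions with a common Lipschitz constant is Lipschitz. This makes suprema over
the uncountable unit ball measurable. -/
lemma continuous_ciSup_of_sub_le {ι E : Type*} [Nonempty ι] [PseudoMetricSpace E] {g : ι → E → ℝ}
    {K : ℝ} (hb : ∀ x, BddAbove (Set.range fun i => g i x))
    (h : ∀ i x y, g i x - g i y ≤ K * dist x y) : Continuous fun x => ⨆ i, g i x := by
  have key : ∀ x y, (⨆ i, g i x) ≤ (⨆ i, g i y) + K * dist x y := fun x y =>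
    ciSup_le fun i => by linarith [h i x y, le_ciSup (hb y) i]
  exact (LipschitzWith.of_le_add_mul' K key).continuous

lemma abs_ciSup_le {ι : Type*} [Nonempty ι] {g : ι → ℝ} {C : ℝ} (h : ∀ i, |g i| ≤ C) :
    |⨆ i, g i| ≤ C := by
  have hb : BddAbove (Set.range g) := ⟨C, by rintro _ ⟨i, rfl⟩; exact (abs_le.1 (h i)).2⟩
  refine abs_le.2 ⟨?_, ciSup_le fun i => (abs_le.1 (h i)).2⟩
  obtain ⟨i⟩ := ‹Nonempty ι›
  exact (abs_le.1 (h i)).1.trans (le_ciSup hb i)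

/-- The variance is nonnegative. -/
lemma integral_le_sqrt_integral_sq {β : Type*} [MeasurableSpace β] {μ : Measure β}
    [IsProbabilityMeasure μ] {X : β → ℝ} (hX : AEStronglyMeasurable X μ)
    (hX2 : Integrable (fun a => X a ^ 2) μ) : ∫ a, X a ∂μ ≤ √(∫ a, X a ^ 2 ∂μ) := by
  have hm : MemLp X 2 μ := (memLp_two_iff_integrable_sq hX).2 hX2
  have hv := variance_nonneg X μ
  rw [variance_eq_sub hm] at hv
  refine Real.le_sqrt_of_sq_le ?_
  simpa using hv

/-! ### Symmetrization and contraction for suprema over the unit ball. -/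

section Symmetrization

lemma nonempty_unitBall {H : Type*} [NormedAddCommGroup H] :
    Nonempty (Metric.closedBall (0 : H) 1) :=
  ⟨⟨0, by simp⟩⟩

variable {H : Type*} [NormedAddCommGroup H] [InnerProductSpace ℝ H]

lemma abs_inner_le_of_mem_unitBall (f : Metric.closedBall (0 : H) 1) (w : H) :
    |⟪(f : H), w⟫_ℝ| ≤ ‖w‖ := by
  have hf : ‖(f : H)‖ ≤ 1 := mem_closedBall_zero_iff.1 f.2
  exact (abs_real_inner_le_norm _ _).trans (mul_le_of_le_one_left (norm_nonneg _) hf)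

/-- The supremum over the unit ball of `⟪f, w⟫ + ∑ q, (φ ⟪f, z q⟫ - b q f)`. -/
noncomputable def ballSup {n : ℕ} (φ : ℝ → ℝ) (b : Fin n → H → ℝ) (w : H) (z : Fin n → H) : ℝ :=
  ⨆ f : Metric.closedBall (0 : H) 1, (⟪(f : H), w⟫_ℝ + ∑ q, (φ ⟪(f : H), z q⟫_ℝ - b q f))

variable {n : ℕ} {φ : ℝ → ℝ} {b : Fin n → H → ℝ} {L : ℝ}

lemma abs_ballSup_term_le (hφ : ∀ t, φ t ∈ Set.Icc (0 : ℝ) 1)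
    (hb : ∀ q f, b q f ∈ Set.Icc (0 : ℝ) 1) (f : Metric.closedBall (0 : H) 1) (w : H)
    (z : Fin n → H) :
    |⟪(f : H), w⟫_ℝ + ∑ q, (φ ⟪(f : H), z q⟫_ℝ - b q f)| ≤ ‖w‖ + n := by
  refine (abs_add_le _ _).trans (add_le_add (abs_inner_le_of_mem_unitBall f w) ?_)
  refine (Finset.abs_sum_le_sum_abs _ _).trans ?_
  calc _ ≤ ∑ q : Fin n, (1 : ℝ) := Finset.sum_le_sum fun q _ => by
        have h1 := hφ ⟪(f : H), z q⟫_ℝ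
        have h2 := hb q f
        exact abs_le.2 ⟨by linarith [h1.1, h2.2], by linarith [h1.2, h2.1]⟩
    _ = n := by simp

lemma bddAbove_ballSup (hφ : ∀ t, φ t ∈ Set.Icc (0 : ℝ) 1)
    (hb : ∀ q f, b q f ∈ Set.Icc (0 : ℝ) 1) (w : H) (z : Fin n → H) :
    BddAbove (Set.range fun f : Metric.closedBall (0 : H) 1 =>
      ⟪(f : H), w⟫_ℝ + ∑ q, (φ ⟪(f : H), z q⟫_ℝ - b q f)) :=
  ⟨‖w‖ + n, by rintro _ ⟨f, rfl⟩; exact (abs_le.1 (abs_ballSup_term_le hφ hb f w z)).2⟩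

lemma le_ballSup (hφ : ∀ t, φ t ∈ Set.Icc (0 : ℝ) 1)
    (hb : ∀ q f, b q f ∈ Set.Icc (0 : ℝ) 1) (f : Metric.closedBall (0 : H) 1) (w : H)
    (z : Fin n → H) :
    ⟪(f : H), w⟫_ℝ + ∑ q, (φ ⟪(f : H), z q⟫_ℝ - b q f) ≤ ballSup φ b w z :=
  le_ciSup (bddAbove_ballSup hφ hb w z) f

lemma abs_ballSup_le (hφ : ∀ t, φ t ∈ Set.Icc (0 : ℝ) 1)
    (hb : ∀ q f, b q f ∈ Set.Icc (0 : ℝ) 1) (w : H) (z : Fin n → H) :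
    |ballSup φ b w z| ≤ ‖w‖ + n :=
  have := nonempty_unitBall (H := H)
  abs_ciSup_le fun f => abs_ballSup_term_le hφ hb f w z

lemma comp_inner_sub_le (hL : 0 ≤ L) (hφL : ∀ s t, φ s - φ t ≤ L * |s - t|)
    (f : Metric.closedBall (0 : H) 1) (x y : H) :
    φ ⟪(f : H), x⟫_ℝ - φ ⟪(f : H), y⟫_ℝ ≤ L * dist x y := by
  refine (hφL _ _).trans (mul_le_mul_of_nonneg_left ?_ hL)
  rw [← inner_sub_right, dist_eq_norm]
  exact abs_inner_le_of_mem_unitBall f _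

lemma continuous_ballSup (hL : 0 ≤ L) (hφ : ∀ t, φ t ∈ Set.Icc (0 : ℝ) 1)
    (hφL : ∀ s t, φ s - φ t ≤ L * |s - t|) (hb : ∀ q f, b q f ∈ Set.Icc (0 : ℝ) 1) :
    Continuous fun p : H × (Fin n → H) => ballSup φ b p.1 p.2 := by
  have := nonempty_unitBall (H := H)
  refine continuous_ciSup_of_sub_le (K := 1 + n * L)
    (fun p => bddAbove_ballSup hφ hb p.1 p.2) fun f p p' => ?_
  have h1 : ⟪(f : H), p.1⟫_ℝ - ⟪(f : H), p'.1⟫_ℝ ≤ dist p p' := by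
    rw [← inner_sub_right]
    refine (le_abs_self _).trans ((abs_inner_le_of_mem_unitBall f _).trans ?_)
    rw [← dist_eq_norm, Prod.dist_eq]
    exact le_max_left _ _
  have h2 : ∑ q, (φ ⟪(f : H), p.2 q⟫_ℝ - b q f) - ∑ q, (φ ⟪(f : H), p'.2 q⟫_ℝ - b q f) ≤
      n * L * dist p p' := by
    rw [← Finset.sum_sub_distrib]
    calc _ ≤ ∑ q : Fin n, L * dist p p' := Finset.sum_le_sum fun q _ => by
          rw [sub_sub_sub_cancel_right]
          refine (comp_inner_sub_le hL hφL f _ _).trans (mul_le_mul_of_nonneg_left ?_ hL)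
          exact (dist_le_pi_dist p.2 p'.2 q).trans (by rw [Prod.dist_eq]; exact le_max_right _ _)
      _ = _ := by simp [mul_assoc]
  linarith

/-- The two-point contraction inequality. -/
lemma ballSup_contraction (hφ : ∀ t, φ t ∈ Set.Icc (0 : ℝ) 1)
    (hφL : ∀ s t, φ s - φ t ≤ L * |s - t|) (hb : ∀ q f, b q f ∈ Set.Icc (0 : ℝ) 1)
    (w x : H) (z : Fin n → H) :
    (⨆ f : Metric.closedBall (0 : H) 1, ((⟪(f : H), w⟫_ℝ + ∑ q, (φ ⟪(f : H), z q⟫_ℝ - b q f)) +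
        2 * φ ⟪(f : H), x⟫_ℝ)) +
      (⨆ f : Metric.closedBall (0 : H) 1, ((⟪(f : H), w⟫_ℝ + ∑ q, (φ ⟪(f : H), z q⟫_ℝ - b q f)) -
        2 * φ ⟪(f : H), x⟫_ℝ)) ≤
      ballSup φ b (w + (2 * L) • x) z + ballSup φ b (w - (2 * L) • x) z := by
  have := nonempty_unitBall (H := H)
  -- Near-maximisers `f`, `g` of the two suprema are compared directly: the sign of `⟪f, x⟫ - ⟪g,
  -- x⟫` decides which of them receives the tilt `+x` and which `-x`.
  rw [← le_sub_iff_add_le]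
  refine ciSup_le fun f => ?_
  rw [le_sub_comm]
  refine ciSup_le fun g => ?_
  have hfp := le_ballSup hφ hb f (w + (2 * L) • x) z
  have hfm := le_ballSup hφ hb f (w - (2 * L) • x) z
  have hgp := le_ballSup hφ hb g (w + (2 * L) • x) z
  have hgm := le_ballSup hφ hb g (w - (2 * L) • x) z
  simp only [inner_add_right, inner_sub_right, real_inner_smul_right] at hfp hfm hgp hgm
  have := hφL ⟪(f : H), x⟫_ℝ ⟪(g : H), x⟫_ℝ
  rcases abs_cases (⟪(f : H), x⟫_ℝ - ⟪(g : H), x⟫_ℝ) with ⟨h, -⟩ | ⟨h, -⟩ <;> rw [h] at this <;>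
    linarith

/-- Concavity of the square root together with the parallelogram law: averaging over the sign of `x`
removes the cross term. -/
lemma half_add_le_sqrt (w x : H) {V : ℝ} (hV : 0 ≤ V) :
    (√(‖w + x‖ ^ 2 + V) + √(‖w - x‖ ^ 2 + V)) / 2 ≤ √(‖w‖ ^ 2 + ‖x‖ ^ 2 + V) := by
  refine Real.le_sqrt_of_sq_le ?_
  have h1 := Real.sq_sqrt (by positivity : 0 ≤ ‖w + x‖ ^ 2 + V)
  have h2 := Real.sq_sqrt (by positivity : 0 ≤ ‖w - x‖ ^ 2 + V)
  have h3 := parallelogram_law_with_norm ℝ w x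
  nlinarith [sq_nonneg (√(‖w + x‖ ^ 2 + V) - √(‖w - x‖ ^ 2 + V))]

variable [MeasurableSpace H] [BorelSpace H] [SecondCountableTopology H]

lemma integral_comp_inner_mem_Icc (hφ : ∀ t, φ t ∈ Set.Icc (0 : ℝ) 1) (hφc : Continuous φ)
    (ν : Measure H) [IsProbabilityMeasure ν] (f : H) :
    ∫ z, φ ⟪f, z⟫_ℝ ∂ν ∈ Set.Icc (0 : ℝ) 1 := by
  refine ⟨integral_nonneg fun z => (hφ _).1, ?_⟩
  calc _ ≤ ∫ z, (1 : ℝ) ∂ν := integral_mono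
        (integrable_of_abs_le (C := 1) (by fun_prop) fun z =>
          abs_le.2 ⟨by linarith [(hφ ⟪f, z⟫_ℝ).1], (hφ _).2⟩) (integrable_const _) fun z => (hφ _).2
    _ = 1 := by simp

/-- Symmetrization and contraction for one coordinate. -/
lemma integral_ballSup_cons_le (hL : 0 ≤ L) (hφ : ∀ t, φ t ∈ Set.Icc (0 : ℝ) 1)
    (hφL : ∀ s t, φ s - φ t ≤ L * |s - t|) (hφc : Continuous φ)
    (hb : ∀ q f, b q f ∈ Set.Icc (0 : ℝ) 1)
    (ν : Measure H) [IsProbabilityMeasure ν] (hν : Integrable (fun z => ‖z‖ ^ 2) ν)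
    (w : H) (z : Fin n → H) :
    ∫ x, ballSup φ (Fin.cons (fun f => ∫ y, φ ⟪f, y⟫_ℝ ∂ν) b : Fin (n + 1) → H → ℝ) w
      (Fin.cons x z) ∂ν ≤
    ∫ x, (ballSup φ b (w + (2 * L) • x) z + ballSup φ b (w - (2 * L) • x) z) / 2 ∂ν := by
  have := nonempty_unitBall (H := H)
  set b₀ : H → ℝ := fun f => ∫ y, φ ⟪f, y⟫_ℝ ∂ν with hb₀
  set G : Metric.closedBall (0 : H) 1 → ℝ := fun f =>
    ⟪(f : H), w⟫_ℝ + ∑ q, (φ ⟪(f : H), z q⟫_ℝ - b q f) with hG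
  -- `A` and `D` carry the two values of a random sign. The centered term splits as half of `G f + 2
  -- * φ ⟪f, x⟫` plus half of `G f - 2 * b₀ f`, and the latter is a mean of terms bounded by `D`. So
  -- `A` and `D` are integrated separately and then recombined at the same `x`.
  set A : H → ℝ := fun x => ⨆ f, (G f + 2 * φ ⟪(f : H), x⟫_ℝ) with hA
  set D : H → ℝ := fun x => ⨆ f, (G f - 2 * φ ⟪(f : H), x⟫_ℝ) with hD
  have hGC : ∀ f, |G f| ≤ ‖w‖ + n := fun f => abs_ballSup_term_le hφ hb f w z
  have hA1 : ∀ f x, |G f + 2 * φ ⟪(f : H), x⟫_ℝ| ≤ ‖w‖ + n + 2 := fun f x => by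
    have := abs_le.1 (hGC f)
    exact abs_le.2 ⟨by linarith [(hφ ⟪(f : H), x⟫_ℝ).1], by linarith [(hφ ⟪(f : H), x⟫_ℝ).2]⟩
  have hD1 : ∀ f x, |G f - 2 * φ ⟪(f : H), x⟫_ℝ| ≤ ‖w‖ + n + 2 := fun f x => by
    have := abs_le.1 (hGC f)
    exact abs_le.2 ⟨by linarith [(hφ ⟪(f : H), x⟫_ℝ).2], by linarith [(hφ ⟪(f : H), x⟫_ℝ).1]⟩
  have hAb : ∀ x, BddAbove (Set.range fun f => G f + 2 * φ ⟪(f : H), x⟫_ℝ) := fun x =>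
    ⟨_, by rintro _ ⟨f, rfl⟩; exact (abs_le.1 (hA1 f x)).2⟩
  have hDb : ∀ x, BddAbove (Set.range fun f => G f - 2 * φ ⟪(f : H), x⟫_ℝ) := fun x =>
    ⟨_, by rintro _ ⟨f, rfl⟩; exact (abs_le.1 (hD1 f x)).2⟩
  have hAc : Continuous A := continuous_ciSup_of_sub_le (K := 2 * L) hAb fun f x y => by
    linarith [comp_inner_sub_le hL hφL f x y]
  have hDc : Continuous D := continuous_ciSup_of_sub_le (K := 2 * L) hDb fun f x y => by
    have := comp_inner_sub_le hL hφL f y x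
    rw [dist_comm] at this
    linarith
  have hAi : Integrable A ν :=
    integrable_of_abs_le hAc.measurable fun x => abs_ciSup_le fun f => hA1 f x
  have hDi : Integrable D ν :=
    integrable_of_abs_le hDc.measurable fun x => abs_ciSup_le fun f => hD1 f x
  have hb' : ∀ q f, (Fin.cons b₀ b : Fin (n + 1) → H → ℝ) q f ∈ Set.Icc (0 : ℝ) 1 := fun q f => by
    refine Fin.cases ?_ (fun k => ?_) q
    · exact integral_comp_inner_mem_Icc hφ hφc ν f
    · simpa using! hb k f
  have hpt : ∀ x, ballSup φ (Fin.cons b₀ b : Fin (n + 1) → H → ℝ) w (Fin.cons x z) ≤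
      A x / 2 + (∫ y, D y ∂ν) / 2 := fun x => by
    refine ciSup_le fun f => ?_
    have h1 : G f + 2 * φ ⟪(f : H), x⟫_ℝ ≤ A x := le_ciSup (hAb x) f
    have hφi : Integrable (fun y => φ ⟪(f : H), y⟫_ℝ) ν :=
      integrable_of_abs_le (C := 1) (by fun_prop) fun y =>
        abs_le.2 ⟨by linarith [(hφ ⟪(f : H), y⟫_ℝ).1], (hφ _).2⟩
    have h2 : G f - 2 * b₀ f ≤ ∫ y, D y ∂ν := by
      have e : ∫ y, (G f - 2 * φ ⟪(f : H), y⟫_ℝ) ∂ν = G f - 2 * b₀ f := by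
        rw [integral_sub (integrable_const _) (hφi.const_mul 2), integral_const_mul]
        simp [hb₀]
      rw [← e]
      exact integral_mono ((integrable_const _).sub (hφi.const_mul 2)) hDi
        fun y => le_ciSup (hDb y) f
    rw [Fin.sum_univ_succ]
    simp only [Fin.cons_zero, Fin.cons_succ]
    simp only [hG] at h1 h2
    linarith
  have hcont : Continuous fun x : H => (Fin.cons x z : Fin (n + 1) → H) := by
    refine continuous_pi fun i => ?_
    refine Fin.cases ?_ (fun k => ?_) i
    · exact continuous_id
    · simpa using continuous_const
  have hSi : ∀ s : ℝ, Integrable (fun x => ballSup φ b (w + s • x) z) ν := fun s => by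
    have hn : Integrable (fun x : H => ‖x‖) ν :=
      ((memLp_two_iff_integrable_sq_norm aestronglyMeasurable_id).2 hν).integrable one_le_two |>.norm
    refine Integrable.mono' (g := fun x => ‖w‖ + |s| * ‖x‖ + n)
      (((integrable_const _).add (hn.const_mul _)).add (integrable_const _)) ?_
      (ae_of_all _ fun x => ?_)
    · exact ((continuous_ballSup hL hφ hφL hb).comp
        (g := fun p : H × (Fin n → H) => ballSup φ b p.1 p.2) (f := fun x => (w + s • x, z))
        (by fun_prop)).measurable.aestronglyMeasurable
    · refine (abs_ballSup_le hφ hb _ z).trans ?_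
      have := norm_add_le w (s • x)
      rw [norm_smul, Real.norm_eq_abs] at this
      linarith
  have hSm : Integrable (fun x => ballSup φ b (w - (2 * L) • x) z) ν := by
    simpa [sub_eq_add_neg] using hSi (-(2 * L))
  calc _ ≤ ∫ x, (A x / 2 + (∫ y, D y ∂ν) / 2) ∂ν := by
        refine integral_mono (integrable_of_abs_le (C := ‖w‖ + (n + 1 : ℕ)) ?_ fun x =>
          abs_ballSup_le hφ hb' _ _) ((hAi.div_const 2).add (integrable_const _)) hpt
        exact ((continuous_ballSup hL hφ hφL hb').comp
          (g := fun p : H × (Fin (n + 1) → H) => ballSup φ _ p.1 p.2)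
          (continuous_const.prodMk hcont)).measurable
    _ = ∫ x, (A x + D x) / 2 ∂ν := by
        rw [integral_add (hAi.div_const 2) (integrable_const _), integral_div _ A,
          integral_div _ (fun x => A x + D x), integral_add hAi hDi]
        simp
        ring
    _ ≤ _ := by
        refine integral_mono ((hAi.add hDi).div_const 2) (((hSi _).add hSm).div_const 2) fun x => ?_
        have := ballSup_contraction hφ hφL hb w x z
        simp only [hA, hD, hG]
        linarith

/-- The expected supremum of the centered process is controlled by the second moments. -/
lemma integral_ballSup_le (hL : 0 ≤ L) (hφ : ∀ t, φ t ∈ Set.Icc (0 : ℝ) 1)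
    (hφL : ∀ s t, φ s - φ t ≤ L * |s - t|) (hφc : Continuous φ)
    (ν : Fin n → Measure H) [∀ q, IsProbabilityMeasure (ν q)]
    (hν : ∀ q, Integrable (fun z => ‖z‖ ^ 2) (ν q)) (w : H) :
    ∫ z, ballSup φ (fun q f => ∫ y, φ ⟪f, y⟫_ℝ ∂(ν q)) w z ∂(Measure.pi ν) ≤
      √(‖w‖ ^ 2 + (2 * L) ^ 2 * ∑ q, ∫ z, ‖z‖ ^ 2 ∂(ν q)) := by
  -- `w` must vary: each processed coordinate `x` becomes a linear tilt, and the induction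
  -- hypothesis is used at `w ± (2 * L) • x`. No explicit random signs are needed.
  induction n generalizing w with
  | zero =>
    have hle : ∀ z : Fin 0 → H, ballSup φ (fun q f => ∫ y, φ ⟪f, y⟫_ℝ ∂(ν q)) w z ≤ ‖w‖ :=
      fun z => by
        have := abs_ballSup_le (b := fun q f => ∫ y, φ ⟪f, y⟫_ℝ ∂(ν q)) hφ
          (fun q => q.elim0) w z
        simpa using (le_abs_self _).trans this
    have h0 : ballSup φ (fun q f => ∫ y, φ ⟪f, y⟫_ℝ ∂(ν q)) w =
        fun _ => ballSup φ (fun q f => ∫ y, φ ⟪f, y⟫_ℝ ∂(ν q)) w default :=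
      funext fun x => congrArg _ (Subsingleton.elim _ _)
    rw [h0]
    simpa using hle default
  | succ n ih =>
    set b : Fin n → H → ℝ := fun q f => ∫ y, φ ⟪f, y⟫_ℝ ∂(ν q.succ) with hb
    have hbI : ∀ q f, b q f ∈ Set.Icc (0 : ℝ) 1 := fun q f =>
      integral_comp_inner_mem_Icc hφ hφc _ f
    have hbI' : ∀ (q : Fin (n + 1)) f, ∫ y, φ ⟪f, y⟫_ℝ ∂(ν q) ∈ Set.Icc (0 : ℝ) 1 := fun q f =>
      integral_comp_inner_mem_Icc hφ hφc _ f
    have hcons : (fun q f => ∫ y, φ ⟪f, y⟫_ℝ ∂(ν q)) =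
        (Fin.cons (fun f => ∫ y, φ ⟪f, y⟫_ℝ ∂(ν 0)) b : Fin (n + 1) → H → ℝ) := by
      funext q
      refine Fin.cases ?_ (fun k => ?_) q <;> rfl
    set π := Measure.pi fun q : Fin n => ν q.succ
    set V := (2 * L) ^ 2 * ∑ q : Fin n, ∫ z, ‖z‖ ^ 2 ∂(ν q.succ) with hV
    have hV0 : 0 ≤ V := mul_nonneg (sq_nonneg _)
      (Finset.sum_nonneg fun q _ => integral_nonneg fun z => sq_nonneg _)
    have hS1 : Integrable (fun p : H × (Fin n → H) =>
        ballSup φ (fun q f => ∫ y, φ ⟪f, y⟫_ℝ ∂(ν q)) w (Fin.cons p.1 p.2)) ((ν 0).prod π) :=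
      integrable_of_abs_le ((((continuous_ballSup hL hφ hφL hbI').comp
        (g := fun p : H × (Fin (n + 1) → H) => ballSup φ _ p.1 p.2)
        (continuous_const.prodMk continuous_id)).measurable).comp measurable_finCons)
        fun p => abs_ballSup_le hφ hbI' _ _
    have hn : Integrable (fun x : H => ‖x‖) (ν 0) :=
      ((memLp_two_iff_integrable_sq_norm aestronglyMeasurable_id).2 (hν 0)).integrable
        one_le_two |>.norm
    have hS2 : ∀ s : ℝ, Integrable (fun p : H × (Fin n → H) => ballSup φ b (w + s • p.1) p.2)
        ((ν 0).prod π) := fun s => by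
      refine Integrable.mono' (g := fun p => ‖w‖ + |s| * ‖p.1‖ + n)
        (((integrable_const _).add ((hn.comp_fst π).const_mul _)).add (integrable_const _)) ?_
        (ae_of_all _ fun x => ?_)
      · exact ((continuous_ballSup hL hφ hφL hbI).comp
          (g := fun p : H × (Fin n → H) => ballSup φ b p.1 p.2)
          (f := fun p : H × (Fin n → H) => (w + s • p.1, p.2))
          (by fun_prop)).measurable.aestronglyMeasurable
      · refine (abs_ballSup_le hφ hbI _ _).trans ?_
        have := norm_add_le w (s • x.1)
        rw [norm_smul, Real.norm_eq_abs] at this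
        linarith
    have hS2m : Integrable (fun p : H × (Fin n → H) =>
        ballSup φ b (w - (2 * L) • p.1) p.2) ((ν 0).prod π) := by
      simpa [sub_eq_add_neg] using hS2 (-(2 * L))
    have hS3 : Integrable (fun p : H × (Fin n → H) =>
        (ballSup φ b (w + (2 * L) • p.1) p.2 + ballSup φ b (w - (2 * L) • p.1) p.2) / 2)
        ((ν 0).prod π) := ((hS2 _).add hS2m).div_const 2
    have hsq : ∀ x : H, √(‖w‖ ^ 2 + ‖(2 * L) • x‖ ^ 2 + V) ^ 2 =
        ‖w‖ ^ 2 + V + (2 * L) ^ 2 * ‖x‖ ^ 2 := fun x => by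
      rw [Real.sq_sqrt (by positivity), norm_smul, mul_pow, Real.norm_eq_abs, sq_abs]
      ring
    have hsqi : Integrable (fun x : H => √(‖w‖ ^ 2 + ‖(2 * L) • x‖ ^ 2 + V) ^ 2) (ν 0) := by
      simp_rw [hsq]
      exact (integrable_const _).add ((hν 0).const_mul _)
    have hsqm : AEStronglyMeasurable (fun x : H => √(‖w‖ ^ 2 + ‖(2 * L) • x‖ ^ 2 + V)) (ν 0) := by
      have : Continuous fun x : H => √(‖w‖ ^ 2 + ‖(2 * L) • x‖ ^ 2 + V) := by fun_prop
      exact this.aestronglyMeasurable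
    rw [integral_pi_succ]
    calc _ ≤ ∫ y, ∫ x, (ballSup φ b (w + (2 * L) • x) y +
          ballSup φ b (w - (2 * L) • x) y) / 2 ∂(ν 0) ∂π := by
          rw [integral_prod_symm _ hS1]
          refine integral_mono hS1.integral_prod_right hS3.integral_prod_right fun y => ?_
          simp only [hcons]
          exact integral_ballSup_cons_le hL hφ hφL hφc hbI (ν 0) (hν 0) w y
      _ = ∫ x, ∫ y, (ballSup φ b (w + (2 * L) • x) y +
          ballSup φ b (w - (2 * L) • x) y) / 2 ∂π ∂(ν 0) := by
          rw [← integral_prod_symm _ hS3, integral_prod _ hS3]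
      _ ≤ ∫ x, √(‖w‖ ^ 2 + ‖(2 * L) • x‖ ^ 2 + V) ∂(ν 0) := by
          refine integral_mono hS3.integral_prod_left
            (((memLp_two_iff_integrable_sq hsqm).2 hsqi).integrable one_le_two) fun x => ?_
          have hi : ∀ v : H, Integrable (fun y => ballSup φ b v y) π := fun v =>
            integrable_of_abs_le ((continuous_ballSup hL hφ hφL hbI).comp
              (g := fun p : H × (Fin n → H) => ballSup φ b p.1 p.2)
              (f := fun y => (v, y)) (by fun_prop)).measurable fun y => abs_ballSup_le hφ hbI _ _
          simp only
          rw [integral_div, integral_add (hi _) (hi _)]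
          refine le_trans ?_ (half_add_le_sqrt w ((2 * L) • x) hV0)
          have h1 := ih (fun q => ν q.succ) (fun q => hν _) (w + (2 * L) • x)
          have h2 := ih (fun q => ν q.succ) (fun q => hν _) (w - (2 * L) • x)
          linarith
      _ ≤ √(∫ x, √(‖w‖ ^ 2 + ‖(2 * L) • x‖ ^ 2 + V) ^ 2 ∂(ν 0)) :=
          integral_le_sqrt_integral_sq hsqm hsqi
      _ = _ := by
          simp_rw [hsq]
          rw [integral_add (integrable_const _) ((hν 0).const_mul _), integral_const_mul,
            Fin.sum_univ_succ, hV]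
          congr 1
          simp
          ring

end Symmetrization

/-! ### The Lipschitz majorant of the indicator. -/

/-- The piecewise linear function equal to `0` on `(-∞, r / 2]` and to `1` on `[r, ∞)`. -/
noncomputable def ramp (r t : ℝ) : ℝ := max 0 (min 1 (2 * t / r - 1))

lemma ramp_mem_Icc (r t : ℝ) : ramp r t ∈ Set.Icc (0 : ℝ) 1 :=
  ⟨le_max_left _ _, max_le zero_le_one (min_le_left _ _)⟩

lemma continuous_ramp (r : ℝ) : Continuous (ramp r) := by
  unfold ramp
  fun_prop

lemma ramp_sub_le {r : ℝ} (hr : 0 < r) (s t : ℝ) : ramp r s - ramp r t ≤ 2 / r * |s - t| := by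
  have h1 : 2 * s / r - 1 - (2 * t / r - 1) ≤ 2 / r * |s - t| := by
    have e : 2 * s / r - 1 - (2 * t / r - 1) = 2 / r * (s - t) := by ring
    rw [e]
    exact mul_le_mul_of_nonneg_left (le_abs_self _) (by positivity)
  have h2 : 0 ≤ 2 / r * |s - t| := by positivity
  have h3 : ramp r s ≤ max 0 (min 1 (2 * t / r - 1)) + 2 / r * |s - t| := by
    refine max_le (by linarith [le_max_left 0 (min 1 (2 * t / r - 1))]) ?_
    refine le_trans ?_ (add_le_add_left (le_max_right _ _) _)
    rw [← min_add_add_right]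
    exact min_le_min (by linarith) (by linarith)
  unfold ramp at h3 ⊢
  linarith

lemma ramp_eq_one {r t : ℝ} (hr : 0 < r) (h : r < t) : ramp r t = 1 := by
  have : 1 ≤ 2 * t / r - 1 := by
    rw [le_sub_iff_add_le, le_div_iff₀ hr]
    linarith
  rw [ramp, min_eq_left this, max_eq_right zero_le_one]

/-- With `u = t / r`, this is `2 * u - 1 ≤ u ^ 2`. It turns a second moment bound into a bound on
the mean of the ramp. -/
lemma ramp_le_sq {r : ℝ} (t : ℝ) : ramp r t ≤ t ^ 2 / r ^ 2 := by
  rw [← div_pow]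
  refine max_le (sq_nonneg _) ((min_le_right _ _).trans ?_)
  have : 2 * t / r = 2 * (t / r) := by ring
  rw [this]
  nlinarith [sq_nonneg (t / r - 1)]

/-! ### Uniform bound on the number of large projections. -/

section Concentration

variable {H : Type*} [NormedAddCommGroup H] [InnerProductSpace ℝ H]

/-- Only the summand `i` changes; its centering cancels and `φ` has range in the unit interval. -/
lemma ballSup_sub_le_one {n : ℕ} {φ : ℝ → ℝ} {b : Fin n → H → ℝ}
    (hφ : ∀ t, φ t ∈ Set.Icc (0 : ℝ) 1) (hb : ∀ q f, b q f ∈ Set.Icc (0 : ℝ) 1) (w : H)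
    (i : Fin n) (x y : Fin n → H) (h : ∀ j, j ≠ i → x j = y j) :
    ballSup φ b w x - ballSup φ b w y ≤ 1 := by
  have := nonempty_unitBall (H := H)
  rw [sub_le_iff_le_add']
  refine ciSup_le fun f => ?_
  have h1 := le_ballSup hφ hb f w y
  have h2 : ∑ q, (φ ⟪(f : H), x q⟫_ℝ - b q f) - ∑ q, (φ ⟪(f : H), y q⟫_ℝ - b q f) ≤ 1 := by
    rw [← Finset.sum_sub_distrib, Finset.sum_eq_single i (fun j _ hj => by rw [h j hj, sub_self])
      (by simp)]
    linarith [(hφ ⟪(f : H), x i⟫_ℝ).2, (hφ ⟪(f : H), y i⟫_ℝ).1]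
  linarith

variable [MeasurableSpace H] [BorelSpace H] [SecondCountableTopology H]

/-- With high probability, uniformly over the unit ball, fewer than `δ * n` of the coordinates of a
vector of independent random elements have a projection exceeding `r`. -/
lemma exists_measurableSet_card_lt {n : ℕ} (hn : 0 < n) (ν : Fin n → Measure H)
    [∀ q, IsProbabilityMeasure (ν q)] (hν : ∀ q, Integrable (fun z => ‖z‖ ^ 2) (ν q))
    {r δ η : ℝ} (hr : 0 ≤ r) (hδ : 0 < δ) (hη₀ : 0 < η) (hη : Real.exp (-(n * δ ^ 2 / 72)) ≤ η)
    (hvar : ∀ q, ∀ f : H, ‖f‖ ≤ 1 → ∫ z, ⟪f, z⟫_ℝ ^ 2 ∂(ν q) ≤ r ^ 2 * (δ / 2))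
    (htr : ∑ q, ∫ z, ‖z‖ ^ 2 ∂(ν q) ≤ (r * (n * δ / 24)) ^ 2) :
    ∃ A : Set (Fin n → H), MeasurableSet A ∧ ENNReal.ofReal (1 - η) ≤ Measure.pi ν A ∧
      ∀ z ∈ A, ∀ f : H, ‖f‖ ≤ 1 →
        ((Finset.univ.filter fun q => r < ⟪f, z q⟫_ℝ).card : ℝ) < δ * n := by
  have hn' : (0 : ℝ) < n := by exact_mod_cast hn
  -- For `r = 0` the ramp is unusable, but `htr` forces every second moment to vanish, so all
  -- coordinates are almost surely zero.
  rcases hr.eq_or_lt with rfl | hr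
  · refine ⟨{0}, measurableSet_singleton _, ?_, ?_⟩
    · have h0 : ∀ q, ∀ᵐ z ∂(ν q), z = 0 := fun q => by
        have h1 : ∫ z, ‖z‖ ^ 2 ∂(ν q) = 0 := by
          refine le_antisymm ?_ (integral_nonneg fun z => sq_nonneg _)
          refine (Finset.single_le_sum (f := fun q => ∫ z, ‖z‖ ^ 2 ∂(ν q))
            (fun q _ => integral_nonneg fun z => sq_nonneg _) (Finset.mem_univ q)).trans ?_
          simpa using htr
        have h2 := (integral_eq_zero_iff_of_nonneg (fun z => sq_nonneg _) (hν q)).1 h1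
        filter_upwards [h2] with z hz
        simpa using hz
      have h3 : ∀ᵐ z ∂(Measure.pi ν), z ∈ ({0} : Set (Fin n → H)) := by
        have : ∀ᵐ z ∂(Measure.pi ν), ∀ q, z q = 0 := ae_all_iff.2 fun q =>
          (measurePreserving_eval ν q).quasiMeasurePreserving.ae (h0 q)
        filter_upwards [this] with z hz
        exact funext hz
      rw [prob_compl_eq_zero_iff (measurableSet_singleton _) |>.1 h3]
      rw [ENNReal.ofReal_le_one]
      linarith
    · rintro _ rfl f -
      simpa using mul_pos hδ hn'
  set φ := ramp r
  set b : Fin n → H → ℝ := fun q f => ∫ z, φ ⟪f, z⟫_ℝ ∂(ν q) with hb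
  have hφ := ramp_mem_Icc r
  have hφL := ramp_sub_le hr
  have hφc := continuous_ramp r
  have hbI : ∀ q f, b q f ∈ Set.Icc (0 : ℝ) 1 := fun q f => integral_comp_inner_mem_Icc hφ hφc _ f
  set F : (Fin n → H) → ℝ := ballSup φ b 0 with hF
  have hFm : Measurable F := ((continuous_ballSup (by positivity) hφ hφL hbI).comp
    (g := fun p : H × (Fin n → H) => ballSup φ b p.1 p.2)
    (f := fun y => ((0 : H), y)) (by fun_prop)).measurable
  have hFC : ∀ x, |F x| ≤ n := fun x => by simpa using abs_ballSup_le hφ hbI 0 x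
  -- `ramp r` has Lipschitz constant `2 / r`, so the bound is `2 * (2 / r) * (r * n * δ / 24) = n *
  -- δ / 6`.
  have hmean : ∫ z, F z ∂(Measure.pi ν) ≤ n * δ / 6 := by
    refine (integral_ballSup_le (by positivity) hφ hφL hφc ν hν 0).trans ?_
    refine Real.sqrt_le_iff.2 ⟨by positivity, ?_⟩
    have h1 := mul_le_mul_of_nonneg_left htr (sq_nonneg (2 * (2 / r)))
    have h2 : (2 * (2 / r)) ^ 2 * (r * (n * δ / 24)) ^ 2 = (n * δ / 6) ^ 2 := by
      field_simp
      ring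
    rw [h2] at h1
    simpa using h1
  have hbq : ∀ q, ∀ f : H, ‖f‖ ≤ 1 → b q f ≤ δ / 2 := fun q f hf => by
    have hi : Integrable (fun z => ⟪f, z⟫_ℝ ^ 2) (ν q) := by
      refine (hν q).mono' (by fun_prop) (ae_of_all _ fun z => ?_)
      rw [Real.norm_eq_abs, abs_pow]
      exact pow_le_pow_left₀ (abs_nonneg _)
        (abs_inner_le_of_mem_unitBall ⟨f, mem_closedBall_zero_iff.2 hf⟩ z) 2
    calc b q f ≤ ∫ z, ⟪f, z⟫_ℝ ^ 2 / r ^ 2 ∂(ν q) := by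
          refine integral_mono (integrable_of_abs_le (C := 1)
            (hφc.measurable.comp (by fun_prop)) fun z => ?_) (hi.div_const _) fun z => ramp_le_sq _
          exact abs_le.2 ⟨by linarith [(hφ ⟪f, z⟫_ℝ).1], (hφ _).2⟩
      _ ≤ r ^ 2 * (δ / 2) / r ^ 2 := by
          rw [integral_div]
          exact div_le_div_of_nonneg_right (hvar q f hf) (sq_nonneg _)
      _ = δ / 2 := by field_simp
  refine ⟨{x | ∫ y, F y ∂(Measure.pi ν) + n * δ / 12 ≤ F x}ᶜ,
    (measurableSet_le measurable_const hFm).compl, ?_, ?_⟩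
  · have hmc := measure_pi_ge_le_of_bounded_differences hn ν F hFm hFC
      (fun i x y h => ballSup_sub_le_one hφ hbI 0 i x y h)
      (by positivity : 0 ≤ n * δ / 12)
    have he : -2 * (n * δ / 12) ^ 2 / n = -(n * δ ^ 2 / 72) := by
      field_simp
      ring
    rw [he] at hmc
    rw [← ENNReal.ofReal_toReal (measure_ne_top (Measure.pi ν) _)]
    refine ENNReal.ofReal_le_ofReal ?_
    change _ ≤ (Measure.pi ν).real _
    rw [probReal_compl_eq_one_sub (measurableSet_le measurable_const hFm)]
    linarith
  · intro z hz f hf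
    have hz' : F z < ∫ y, F y ∂(Measure.pi ν) + n * δ / 12 := by simpa using hz
    have h1 := le_ballSup hφ hbI ⟨f, mem_closedBall_zero_iff.2 hf⟩ 0 z
    simp only [inner_zero_right, zero_add, Finset.sum_sub_distrib] at h1
    have h2 : ∑ q, b q f ≤ n * (δ / 2) := by
      calc _ ≤ ∑ q : Fin n, δ / 2 := Finset.sum_le_sum fun q _ => hbq q f hf
        _ = _ := by simp
    have h3 : ((Finset.univ.filter fun q => r < ⟪f, z q⟫_ℝ).card : ℝ) ≤ ∑ q, φ ⟪f, z q⟫_ℝ := by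
      rw [Finset.card_filter]
      push_cast
      refine Finset.sum_le_sum fun q _ => ?_
      split_ifs with h
      · exact (ramp_eq_one hr h).ge
      · exact (hφ _).1
    -- The three contributions are `δ/2` (means), `δ/6` (expected supremum) and `δ/12` (deviation),
    -- each times `n`: strictly less than `δ * n`.
    have h4 := mul_pos hδ hn'
    change _ ≤ F z at h1
    linarith

end Concentration

/-! ### Medians and counting. -/

lemma median_le_of_card_lt {n : ℕ} (hn : 0 < n) (z : Fin n → ℝ) {c : ℝ}
    (h : 2 * (Finset.univ.filter fun q => c < z q).card < n) : median z ≤ c := by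
  -- Both middle positions are at most `n / 2`. If the value at sorted position `k` exceeded `c`, so
  -- would those at the `n - k` positions from `k` on, at least half of all.
  have key : ∀ k : Fin n, (k : ℕ) ≤ n / 2 → z (Tuple.sort z k) ≤ c := fun k hk => by
    by_contra! hlt
    have hsub : (Finset.Ici k).image (Tuple.sort z) ⊆ Finset.univ.filter fun q => c < z q := by
      intro q hq
      obtain ⟨j, hj, rfl⟩ := Finset.mem_image.1 hq
      simp only [Finset.mem_filter, Finset.mem_univ, true_and]
      exact hlt.trans_le (Tuple.monotone_sort z (Finset.mem_Ici.1 hj))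
    have := Finset.card_le_card hsub
    rw [Finset.card_image_of_injective _ (Tuple.sort z).injective, Fin.card_Ici] at this
    omega
  rw [median, dif_pos hn]
  have h1 := key ⟨(n - 1) / 2, by omega⟩ (by simp only; omega)
  have h2 := key ⟨n / 2, by omega⟩ le_rfl
  linarith

lemma le_median_of_card_lt {n : ℕ} (hn : 0 < n) (z : Fin n → ℝ) {c : ℝ}
    (h : 2 * (Finset.univ.filter fun q => z q < c).card < n) : c ≤ median z := by
  have key : ∀ k : Fin n, (n - 1) / 2 ≤ (k : ℕ) → c ≤ z (Tuple.sort z k) := fun k hk => by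
    by_contra! hlt
    have hsub : (Finset.Iic k).image (Tuple.sort z) ⊆ Finset.univ.filter fun q => z q < c := by
      intro q hq
      obtain ⟨j, hj, rfl⟩ := Finset.mem_image.1 hq
      simp only [Finset.mem_filter, Finset.mem_univ, true_and]
      exact (Tuple.monotone_sort z (Finset.mem_Iic.1 hj)).trans_lt hlt
    have := Finset.card_le_card hsub
    rw [Finset.card_image_of_injective _ (Tuple.sort z).injective, Fin.card_Iic] at this
    omega
  rw [median, dif_pos hn]
  have h1 := key ⟨(n - 1) / 2, by omega⟩ le_rfl
  have h2 := key ⟨n / 2, by omega⟩ (by simp only; omega)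
  linarith

/-! ### From counting blocks to the estimator. -/

section Deterministic

variable {H : Type*} [NormedAddCommGroup H] [InnerProductSpace ℝ H]

/-- If every projection exceeds that of `μ` by more than `r` on less than half of the blocks, then
the median-of-means supremum is `r`-close to `‖μ‖`. -/
lemma abs_iSup_median_sub_norm_le {n : ℕ} (hn : 0 < n) (w : Fin n → H) (μ : H) {r : ℝ}
    (h : ∀ f : H, ‖f‖ ≤ 1 → 2 * (Finset.univ.filter fun q => r < ⟪f, w q - μ⟫_ℝ).card < n) :
    |(⨆ f : Metric.closedBall (0 : H) 1, median fun q => ⟪(f : H), w q⟫_ℝ) - ‖μ‖| ≤ r := by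
  have := nonempty_unitBall (H := H)
  have hle : ∀ f : Metric.closedBall (0 : H) 1, (median fun q => ⟪(f : H), w q⟫_ℝ) ≤ ‖μ‖ + r :=
    fun f => by
      refine (median_le_of_card_lt hn _ (c := ⟪(f : H), μ⟫_ℝ + r) ?_).trans ?_
      · simpa only [inner_sub_right, lt_sub_iff_add_lt'] using h f (mem_closedBall_zero_iff.1 f.2)
      · linarith [le_abs_self ⟪(f : H), μ⟫_ℝ, abs_inner_le_of_mem_unitBall f μ]
  have hge : ∀ f : Metric.closedBall (0 : H) 1,
      ⟪(f : H), μ⟫_ℝ - r ≤ median fun q => ⟪(f : H), w q⟫_ℝ := fun f => by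
    refine le_median_of_card_lt hn _ ?_
    -- A deviation below `-r` along `f` is one above `r` along `-f`.
    have e := h (-f) (by rw [norm_neg]; exact mem_closedBall_zero_iff.1 f.2)
    rwa [Finset.filter_congr (q := fun q => ⟪(f : H), w q⟫_ℝ < ⟪(f : H), μ⟫_ℝ - r) fun q _ => by
      rw [inner_neg_left, inner_sub_right]
      constructor <;> intro h <;> linarith] at e
  have hbdd : BddAbove (Set.range fun f : Metric.closedBall (0 : H) 1 =>
      median fun q => ⟪(f : H), w q⟫_ℝ) := ⟨_, by rintro _ ⟨f, rfl⟩; exact hle f⟩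
  refine abs_le.2 ⟨?_, by linarith [ciSup_le hle]⟩
  -- The supremum defining the norm is attained at the normalised `μ`, or at `0` when `μ = 0`.
  obtain ⟨f, hf⟩ : ∃ f : Metric.closedBall (0 : H) 1, ⟪(f : H), μ⟫_ℝ = ‖μ‖ := by
    rcases eq_or_ne μ 0 with rfl | hμ
    · exact ⟨⟨0, by simp⟩, by simp⟩
    · refine ⟨⟨‖μ‖⁻¹ • μ, ?_⟩, ?_⟩
      · rw [mem_closedBall_zero_iff, norm_smul, norm_inv, norm_norm,
          inv_mul_cancel₀ (norm_ne_zero_iff.2 hμ)]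
      · simp only
        rw [real_inner_smul_left, real_inner_self_eq_norm_sq]
        field_simp
  have h1 := hge f
  have h2 := le_ciSup hbdd f
  rw [hf] at h1
  linarith

/-- The number of blocks hit by a set of indices is at most the cardinality of that set. -/
lemma card_blocks_meeting_le {N Q : ℕ} (S : Fin Q → Finset (Fin N)) (hS : ∀ n, ∃! q, n ∈ S q)
    (C : Finset (Fin N)) :
    (Finset.univ.filter fun q => ∃ n ∈ S q, n ∈ C).card ≤ C.card := by
  choose g hg hg' using hS
  refine (Finset.card_le_card (t := C.image g) fun q hq => ?_).trans Finset.card_image_le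
  obtain ⟨n, hn, hC⟩ := (Finset.mem_filter.1 hq).2
  exact Finset.mem_image.2 ⟨n, hC, (hg' n q hn).symm⟩

end Deterministic

/-! ### Integrated Parseval identity. -/

section SecondMoments

variable {H : Type*} [NormedAddCommGroup H] [InnerProductSpace ℝ H]

/-- Orthonormal vectors lie `√2` apart, so they form a discrete subset of a separable space. -/
lemma countable_of_orthonormal [SecondCountableTopology H] {ι : Type*} {e : ι → H}
    (he : Orthonormal ℝ e) : Countable ι := by
  have hinj : Function.Injective e := he.linearIndependent.injective
  have hd : DiscreteTopology (Set.range e) := by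
    refine DiscreteTopology.of_forall_le_dist one_pos ?_
    rintro ⟨_, i, rfl⟩ ⟨_, j, rfl⟩ hij
    have hij' : i ≠ j := fun h => hij (by subst h; rfl)
    rw [Subtype.dist_eq, dist_eq_norm]
    have : ‖e i - e j‖ ^ 2 = 2 := by
      rw [norm_sub_sq_real, he.1 i, he.1 j, he.2 hij']
      norm_num
    nlinarith [norm_nonneg (e i - e j)]
  have : Countable (Set.range e) := TopologicalSpace.separableSpace_iff_countable.1 inferInstance
  exact (Set.rangeFactorization_injective.2 hinj).countable

variable [CompleteSpace H] [SecondCountableTopology H]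

/-- Parseval's identity, integrated. -/
lemma hasSum_integral_inner_sq {α : Type*} [MeasurableSpace α] {μ : Measure α} {ξ : α → H}
    (hm : AEStronglyMeasurable ξ μ) (hξ : Integrable (fun a => ‖ξ a‖ ^ 2) μ) :
    HasSum (fun i => ∫ a, ⟪onb H i, ξ a⟫_ℝ ^ 2 ∂μ) (∫ a, ‖ξ a‖ ^ 2 ∂μ) := by
  have := countable_of_orthonormal (onb H).orthonormal
  have hint : ∀ i, Integrable (fun a => ⟪onb H i, ξ a⟫_ℝ ^ 2) μ := fun i => by
    refine hξ.mono' ((aestronglyMeasurable_const.inner hm).pow 2) (ae_of_all _ fun a => ?_)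
    rw [Real.norm_eq_abs, abs_pow]
    exact pow_le_pow_left₀ (abs_nonneg _) (abs_inner_le_of_mem_unitBall
      ⟨onb H i, mem_closedBall_zero_iff.2 ((onb H).orthonormal.1 i).le⟩ (ξ a)) 2
  have hpars : ∀ a, ∑' i, ⟪onb H i, ξ a⟫_ℝ ^ 2 = ‖ξ a‖ ^ 2 := fun a => by
    have := (onb H).tsum_inner_mul_inner (ξ a) (ξ a)
    rw [real_inner_self_eq_norm_sq] at this
    rw [← this]
    exact tsum_congr fun i => by rw [sq, real_inner_comm (ξ a)]
  -- Bessel's inequality bounds all finite partial sums, which justifies exchanging the sum and the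
  -- integral.
  have hsum : Summable fun i => ∫ a, ‖⟪onb H i, ξ a⟫_ℝ ^ 2‖ ∂μ := by
    refine summable_of_sum_le (c := ∫ a, ‖ξ a‖ ^ 2 ∂μ)
      (fun i => integral_nonneg fun a => norm_nonneg _) fun s => ?_
    rw [← integral_finsetSum _ fun i _ => (hint i).norm]
    refine integral_mono (integrable_finsetSum _ fun i _ => (hint i).norm) hξ fun a => ?_
    have := (onb H).orthonormal.sum_inner_products_le (ξ a) (s := s)
    simpa using this
  have := hasSum_integral_of_summable_integral_norm hint hsum
  simpa only [hpars] using this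

end SecondMoments

/-! ### The feature map and moments of the centered feature. -/

section Feature

variable {𝒳 : Type*} {H : Type*} [NormedAddCommGroup H] [InnerProductSpace ℝ H]
  [CompleteSpace H] [RKHS ℝ H 𝒳 ℝ]

lemma inner_feature (x y : 𝒳) : ⟪feature H y, feature H x⟫_ℝ = kernelFn H x y := by
  have := RKHS.kernel_inner H x y (1 : ℝ) (1 : ℝ)
  unfold feature kernelFn
  rw [← this]
  simp

lemma norm_feature_sq (x : 𝒳) : ‖feature H x‖ ^ 2 = kernelFn H x x := by
  rw [← inner_feature, real_inner_self_eq_norm_sq]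

lemma continuous_feature [TopologicalSpace 𝒳]
    (hK : Continuous fun p : 𝒳 × 𝒳 => kernelFn H p.1 p.2) : Continuous (feature H : 𝒳 → H) := by
  refine continuous_iff_continuousAt.2 fun x => ?_
  rw [ContinuousAt, tendsto_iff_norm_sub_tendsto_zero]
  have h1 : ∀ y, ‖feature H y - feature H x‖ =
      √(kernelFn H y y - 2 * kernelFn H x y + kernelFn H x x) := fun y => by
    rw [← norm_feature_sq, ← norm_feature_sq, ← inner_feature, ← norm_sub_sq_real,
      Real.sqrt_sq (norm_nonneg _)]
  simp_rw [h1]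
  have h2 : Continuous fun y => √(kernelFn H y y - 2 * kernelFn H x y + kernelFn H x x) :=
    (((hK.comp (continuous_id.prodMk continuous_id)).sub
      ((hK.comp (continuous_const.prodMk continuous_id)).const_mul 2)).add continuous_const).sqrt
  have h3 : √(kernelFn H x x - 2 * kernelFn H x x + kernelFn H x x) = 0 := by
    rw [← Real.sqrt_zero]; congr 1; ring
  have := h2.tendsto x
  rwa [h3] at this

/-- The features have a separable range, and their span is dense in `H`. -/
lemma secondCountableTopology_of_continuous_feature [TopologicalSpace 𝒳]
    [TopologicalSpace.SeparableSpace 𝒳] (hc : Continuous (feature H : 𝒳 → H)) :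
    SecondCountableTopology H := by
  have h1 : TopologicalSpace.IsSeparable (Set.range (feature H : 𝒳 → H)) :=
    TopologicalSpace.isSeparable_range hc
  have h2 := (h1.span (R := ℝ)).closure
  have h3 : closure (Submodule.span ℝ (Set.range (feature H : 𝒳 → H)) : Set H) = Set.univ := by
    have h4 := RKHS.kerFun_dense (𝕜 := ℝ) (X := 𝒳) (V := ℝ) H
    have h5 : Submodule.span ℝ {RKHS.kerFun H x v | (x : 𝒳) (v : ℝ)} ≤
        Submodule.span ℝ (Set.range (feature H : 𝒳 → H)) := by
      refine Submodule.span_le.2 ?_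
      rintro _ ⟨x, v, rfl⟩
      have : RKHS.kerFun H x v = v • feature H x := by
        rw [feature, ← map_smul, smul_eq_mul, mul_one]
      rw [this]
      exact Submodule.smul_mem _ _ (Submodule.subset_span ⟨x, rfl⟩)
    have h6 := Submodule.topologicalClosure_mono h5
    rw [h4, top_le_iff] at h6
    rw [← Submodule.topologicalClosure_coe, h6, Submodule.top_coe]
  rw [h3] at h2
  have : TopologicalSpace.SeparableSpace H := TopologicalSpace.isSeparable_univ_iff.1 h2
  exact UniformSpace.secondCountable_of_separable H

variable [MeasurableSpace 𝒳] [SecondCountableTopology H] [MeasurableSpace H] [BorelSpace H]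
  {P : Measure 𝒳} [IsProbabilityMeasure P]

lemma integrable_feature (hf : Measurable (feature H : 𝒳 → H))
    (hP : Integrable (fun x => kernelFn H x x) P) : Integrable (feature H : 𝒳 → H) P :=
  ((memLp_two_iff_integrable_sq_norm hf.aestronglyMeasurable).2
    (by simpa only [norm_feature_sq] using hP)).integrable one_le_two

lemma integrable_norm_centered_feature_sq (hf : Measurable (feature H : 𝒳 → H))
    (hP : Integrable (fun x => kernelFn H x x) P) :
    Integrable (fun x => ‖feature H x - meanEmbedding H P‖ ^ 2) P :=
  (memLp_two_iff_integrable_sq_norm (hf.sub_const _).aestronglyMeasurable).1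
    (((memLp_two_iff_integrable_sq_norm hf.aestronglyMeasurable).2
      (by simpa only [norm_feature_sq] using hP)).sub (memLp_const _))

lemma inner_covOp_self (hf : Measurable (feature H : 𝒳 → H))
    (hP : Integrable (fun x => kernelFn H x x) P) (f : H) :
    ⟪covOp H P f, f⟫_ℝ = ∫ x, ⟪f, feature H x - meanEmbedding H P⟫_ℝ ^ 2 ∂P := by
  have hξ : StronglyMeasurable fun x : 𝒳 => feature H x - meanEmbedding H P :=
    (hf.sub_const _).stronglyMeasurable
  have hc : Continuous fun v : H => InnerProductSpace.rankOne ℝ v v := by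
    have : Continuous fun v : H => (InnerProductSpace.rankOne ℝ v : H →L⋆[ℝ] H →L[ℝ] H) :=
      (InnerProductSpace.rankOne ℝ).continuous
    exact this.clm_apply continuous_id
  have hint : Integrable (fun x => InnerProductSpace.rankOne ℝ
      (feature H x - meanEmbedding H P) (feature H x - meanEmbedding H P)) P := by
    refine (integrable_norm_centered_feature_sq hf hP).mono'
      (hc.comp_stronglyMeasurable hξ).aestronglyMeasurable (ae_of_all _ fun x => ?_)
    rw [InnerProductSpace.norm_rankOne, sq]
  have h1 : covOp H P f = ∫ x, ⟪feature H x - meanEmbedding H P, f⟫_ℝ •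
      (feature H x - meanEmbedding H P) ∂P := by
    rw [covOp, ContinuousLinearMap.integral_apply hint]
    rfl
  have hint' : Integrable (fun x => ⟪feature H x - meanEmbedding H P, f⟫_ℝ •
      (feature H x - meanEmbedding H P)) P := hint.apply_continuousLinearMap f
  rw [h1, real_inner_comm, ← integral_inner hint']
  refine integral_congr_ae (ae_of_all _ fun x => ?_)
  simp only
  rw [real_inner_smul_right, real_inner_comm, sq]

lemma integral_inner_centered_feature_sq_le (hf : Measurable (feature H : 𝒳 → H))
    (hP : Integrable (fun x => kernelFn H x x) P) {f : H} (hf1 : ‖f‖ ≤ 1) :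
    ∫ x, ⟪f, feature H x - meanEmbedding H P⟫_ℝ ^ 2 ∂P ≤ ‖covOp H P‖ := by
  rw [← inner_covOp_self hf hP]
  calc _ ≤ ‖covOp H P f‖ * ‖f‖ := real_inner_le_norm _ _
    _ ≤ ‖covOp H P‖ * ‖f‖ * ‖f‖ :=
        mul_le_mul_of_nonneg_right ((covOp H P).le_opNorm f) (norm_nonneg _)
    _ ≤ ‖covOp H P‖ * 1 * 1 := by gcongr
    _ = _ := by ring

lemma trace_covOp (hf : Measurable (feature H : 𝒳 → H))
    (hP : Integrable (fun x => kernelFn H x x) P) :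
    trace (covOp H P) = ∫ x, ‖feature H x - meanEmbedding H P‖ ^ 2 ∂P := by
  have := hasSum_integral_inner_sq (μ := P) (ξ := fun x => feature H x - meanEmbedding H P)
    (hf.sub_const _).aestronglyMeasurable (integrable_norm_centered_feature_sq hf hP)
  rw [← this.tsum_eq, trace]
  exact tsum_congr fun i => inner_covOp_self hf hP _

lemma integral_centered_feature (hf : Measurable (feature H : 𝒳 → H))
    (hP : Integrable (fun x => kernelFn H x x) P) :
    ∫ x, (feature H x - meanEmbedding H P) ∂P = 0 := by
  rw [integral_sub (integrable_feature hf hP) (integrable_const _)]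
  simp [meanEmbedding]

lemma integral_inner_centered_feature (hf : Measurable (feature H : 𝒳 → H))
    (hP : Integrable (fun x => kernelFn H x x) P) (f : H) :
    ∫ x, ⟪f, feature H x - meanEmbedding H P⟫_ℝ ∂P = 0 := by
  have hi : Integrable (fun x => feature H x - meanEmbedding H P) P :=
    (integrable_feature hf hP).sub (integrable_const _)
  rw [integral_inner hi, integral_centered_feature hf hP, inner_zero_right]

end Feature

/-! ### Independence and second moments of block sums. -/

section Blocks

variable {Ω : Type*} [MeasurableSpace Ω] {ν : Measure Ω}

/-- Tuples of independent random variables over pairwise disjoint index sets are independent. -/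
lemma iIndepFun_tuples {ι κ E : Type*} [Countable κ] [DecidableEq ι] [MeasurableSpace E] {U : ι → Ω → E}
    (hU : ∀ i, Measurable (U i)) (hind : iIndepFun U ν) (T : κ → Finset ι)
    (hT : ∀ q q', q ≠ q' → Disjoint (T q) (T q')) :
    iIndepFun (fun q ω (i : T q) => U i ω) ν := by
  classical
  have := hind.isProbabilityMeasure
  rw [iIndepFun_iff_measure_inter_preimage_eq_mul]
  intro s
  induction s using Finset.induction_on with
  | empty => intro A _; simp
  | insert q s hq ih =>
    intro A hA
    rw [Finset.set_biInter_insert, Finset.prod_insert hq,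
      ← ih fun i hi => hA i (Finset.mem_insert_of_mem hi)]
    -- The block `q` is independent of the union of the blocks in `s`; the events of the latter are
    -- encoded as one event `D` on that union.
    have hdisj : Disjoint (T q) (s.biUnion T) := (Finset.disjoint_biUnion_right _ _ _).2
      fun q' hq' => hT q q' fun h => hq (h ▸ hq')
    have hi := hind.indepFun_finset _ _ hdisj hU
    set D : Set (s.biUnion T → E) := {v | ∀ q' (h : q' ∈ s),
      (fun i : T q' => v ⟨i, Finset.mem_biUnion.2 ⟨q', h, i.2⟩⟩) ∈ A q'} with hD
    have hDm : MeasurableSet D := by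
      rw [hD]
      simp only [Set.ofPred_forall]
      refine MeasurableSet.iInter fun q' => MeasurableSet.iInter fun h => ?_
      exact measurableSet_preimage (t := A q')
        (measurable_pi_iff.2 fun i => measurable_pi_apply _) (hA q' (Finset.mem_insert_of_mem h))
    have hpre : (⋂ q' ∈ s, (fun ω (i : T q') => U i ω) ⁻¹' A q') =
        (fun ω (i : s.biUnion T) => U i ω) ⁻¹' D := by
      ext ω
      simp [hD]
    rw [hpre]
    exact hi.measure_inter_preimage_eq_mul _ _ (hA q (Finset.mem_insert_self _ _)) hDm

variable {H : Type*} [NormedAddCommGroup H] [InnerProductSpace ℝ H]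
  [MeasurableSpace H] [BorelSpace H] [SecondCountableTopology H]

lemma iIndepFun_linearCombinations {ι κ : Type*} [Countable κ] [DecidableEq ι] {U : ι → Ω → H}
    (hU : ∀ i, Measurable (U i)) (hind : iIndepFun U ν) (T : κ → Finset ι)
    (hT : ∀ q q', q ≠ q' → Disjoint (T q) (T q')) (a : κ → ι → ℝ) :
    iIndepFun (fun q ω => ∑ i ∈ T q, a q i • U i ω) ν := by
  have := (iIndepFun_tuples hU hind T hT).comp
    (fun q (v : T q → H) => ∑ i : T q, a q i • v i) (fun q => by fun_prop)
  convert this using 2 with q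
  funext ω
  exact (Finset.sum_coe_sort (T q) fun i => a q i • U i ω).symm

lemma integral_inner_linearCombination_sq {ι : Type*} {U : ι → Ω → H}
    (hU : ∀ i, Measurable (U i)) (hind : iIndepFun U ν)
    (hU2 : ∀ i, Integrable (fun ω => ‖U i ω‖ ^ 2) ν) (f : H)
    (hU0 : ∀ i, ∫ ω, ⟪f, U i ω⟫_ℝ ∂ν = 0)
    (T : Finset ι) (a : ι → ℝ) :
    ∫ ω, ⟪f, ∑ i ∈ T, a i • U i ω⟫_ℝ ^ 2 ∂ν = ∑ i ∈ T, a i ^ 2 * ∫ ω, ⟪f, U i ω⟫_ℝ ^ 2 ∂ν := by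
  have := hind.isProbabilityMeasure
  have hfU : ∀ i, MemLp (fun ω => ⟪f, U i ω⟫_ℝ) 2 ν := fun i =>
    ((memLp_two_iff_integrable_sq_norm (hU i).aestronglyMeasurable).2 (hU2 i)).const_inner f
  have hmem : ∀ i, MemLp (fun ω => a i * ⟪f, U i ω⟫_ℝ) 2 ν := fun i => (hfU i).const_mul _
  have hsum : ∀ ω, ⟪f, ∑ i ∈ T, a i • U i ω⟫_ℝ = (∑ i ∈ T, fun ω => a i * ⟪f, U i ω⟫_ℝ) ω :=
    fun ω => by simp [inner_sum, real_inner_smul_right]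
  have hind' : iIndepFun (fun i ω => a i * ⟪f, U i ω⟫_ℝ) ν :=
    hind.comp (fun i v => a i * ⟪f, v⟫_ℝ) fun i => by fun_prop
  have hzero : ∀ i, ∫ ω, a i * ⟪f, U i ω⟫_ℝ ∂ν = 0 := fun i => by
    rw [integral_const_mul, hU0, mul_zero]
  have hv := IndepFun.variance_sum (s := T) (fun i _ => hmem i)
    fun i _ j _ hij => hind'.indepFun hij
  simp_rw [hsum]
  rw [← variance_of_integral_eq_zero, hv]
  · refine Finset.sum_congr rfl fun i _ => ?_
    rw [variance_const_mul, variance_of_integral_eq_zero (hfU i).aemeasurable (hU0 i)]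
  · exact (memLp_finsetSum' _ fun i _ => hmem i).aemeasurable
  · simp only [Finset.sum_apply]
    rw [integral_finsetSum _ fun i _ => (hmem i).integrable one_le_two]
    exact Finset.sum_eq_zero fun i _ => hzero i

lemma integrable_norm_linearCombination_sq {ι : Type*} {U : ι → Ω → H}
    (hU : ∀ i, Measurable (U i)) (hU2 : ∀ i, Integrable (fun ω => ‖U i ω‖ ^ 2) ν)
    (T : Finset ι) (a : ι → ℝ) : Integrable (fun ω => ‖∑ i ∈ T, a i • U i ω‖ ^ 2) ν := by
  have : MemLp (fun ω => ∑ i ∈ T, a i • U i ω) 2 ν := memLp_finsetSum _ fun i _ =>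
    ((memLp_two_iff_integrable_sq_norm (hU i).aestronglyMeasurable).2 (hU2 i)).const_smul (a i)
  exact (memLp_two_iff_integrable_sq_norm this.1).1 this

/-- The scalar identity holds along each basis vector; Parseval sums it over the basis. -/
lemma integral_norm_linearCombination_sq [CompleteSpace H] {ι : Type*} {U : ι → Ω → H}
    (hU : ∀ i, Measurable (U i)) (hind : iIndepFun U ν)
    (hU2 : ∀ i, Integrable (fun ω => ‖U i ω‖ ^ 2) ν) (hU0 : ∀ i, ∀ f, ∫ ω, ⟪f, U i ω⟫_ℝ ∂ν = 0)
    (T : Finset ι) (a : ι → ℝ) :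
    ∫ ω, ‖∑ i ∈ T, a i • U i ω‖ ^ 2 ∂ν = ∑ i ∈ T, a i ^ 2 * ∫ ω, ‖U i ω‖ ^ 2 ∂ν := by
  have hm : Measurable fun ω => ∑ i ∈ T, a i • U i ω := by fun_prop
  have h1 := hasSum_integral_inner_sq hm.aestronglyMeasurable
    (integrable_norm_linearCombination_sq hU hU2 T a)
  have h2 : HasSum (fun j => ∑ i ∈ T, a i ^ 2 * ∫ ω, ⟪onb H j, U i ω⟫_ℝ ^ 2 ∂ν)
      (∑ i ∈ T, a i ^ 2 * ∫ ω, ‖U i ω‖ ^ 2 ∂ν) := hasSum_sum fun i _ =>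
    (hasSum_integral_inner_sq (hU i).aestronglyMeasurable (hU2 i)).mul_left _
  simp_rw [integral_inner_linearCombination_sq hU hind hU2 _ (fun i => hU0 i _) T a] at h1
  exact h1.unique h2

end Blocks

/-! ### The good event on the sample space. -/

section BlockEvent

variable {Ω : Type*} [MeasurableSpace Ω] {ν : Measure Ω}
  {H : Type*} [NormedAddCommGroup H] [InnerProductSpace ℝ H] [CompleteSpace H]
  [MeasurableSpace H] [BorelSpace H] [SecondCountableTopology H]

/-- Uniform control of the number of deviating blocks, for linear combinations over disjoint blocks
of independent centered square-integrable random elements. -/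
lemma exists_event_card_lt {ι : Type*} [Finite ι] [DecidableEq ι] {U : ι → Ω → H}
    (hU : ∀ i, AEMeasurable (U i) ν) (hind : iIndepFun U ν)
    (hU2 : ∀ i, Integrable (fun ω => ‖U i ω‖ ^ 2) ν) (hU0 : ∀ i, ∀ f, ∫ ω, ⟪f, U i ω⟫_ℝ ∂ν = 0)
    {Q : ℕ} (hQ : 0 < Q) (T : Fin Q → Finset ι) (hT : ∀ q q', q ≠ q' → Disjoint (T q) (T q'))
    (a : Fin Q → ι → ℝ) {r δ η : ℝ} (hr : 0 ≤ r) (hδ : 0 < δ) (hη₀ : 0 < η)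
    (hη : Real.exp (-(Q * δ ^ 2 / 72)) ≤ η)
    (hvar : ∀ q, ∀ f : H, ‖f‖ ≤ 1 →
      ∑ i ∈ T q, a q i ^ 2 * ∫ ω, ⟪f, U i ω⟫_ℝ ^ 2 ∂ν ≤ r ^ 2 * (δ / 2))
    (htr : ∑ q, ∑ i ∈ T q, a q i ^ 2 * ∫ ω, ‖U i ω‖ ^ 2 ∂ν ≤ (r * (Q * δ / 24)) ^ 2) :
    ∃ E : Set Ω, MeasurableSet E ∧ ENNReal.ofReal (1 - η) ≤ ν E ∧ ∀ ω ∈ E, ∀ f : H, ‖f‖ ≤ 1 →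
      ((Finset.univ.filter fun q => r < ⟪f, ∑ i ∈ T q, a q i • U i ω⟫_ℝ).card : ℝ) < δ * Q := by
  have := hind.isProbabilityMeasure
  -- The variables are only almost everywhere measurable. The count is done for measurable versions
  -- `W`, and a measurable null set containing the disagreements is then removed, so the conclusion
  -- holds pointwise on the event.
  set W : ι → Ω → H := fun i => (hU i).mk (U i) with hW
  have hWm : ∀ i, Measurable (W i) := fun i => (hU i).measurable_mk
  have hUW : ∀ i, U i =ᵐ[ν] W i := fun i => (hU i).ae_eq_mk
  have hWind : iIndepFun W ν := hind.congr hUW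
  have hW2 : ∀ i, Integrable (fun ω => ‖W i ω‖ ^ 2) ν := fun i =>
    (hU2 i).congr ((hUW i).mono fun ω h => by simp only [h])
  have hWinner : ∀ i (f : H), ∫ ω, ⟪f, W i ω⟫_ℝ ^ 2 ∂ν = ∫ ω, ⟪f, U i ω⟫_ℝ ^ 2 ∂ν := fun i f =>
    integral_congr_ae ((hUW i).mono fun ω h => by simp only [h])
  have hWnorm : ∀ i, ∫ ω, ‖W i ω‖ ^ 2 ∂ν = ∫ ω, ‖U i ω‖ ^ 2 ∂ν := fun i =>
    integral_congr_ae ((hUW i).mono fun ω h => by simp only [h])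
  have hW0 : ∀ i (f : H), ∫ ω, ⟪f, W i ω⟫_ℝ ∂ν = 0 := fun i f => by
    rw [← hU0 i f]
    exact integral_congr_ae ((hUW i).mono fun ω h => by simp only [h])
  set Z : Fin Q → Ω → H := fun q ω => ∑ i ∈ T q, a q i • W i ω with hZ
  have hZm : ∀ q, Measurable (Z q) := fun q => by fun_prop
  have hZind : iIndepFun Z ν := iIndepFun_linearCombinations hWm hWind T hT a
  have hprob : ∀ q, IsProbabilityMeasure (ν.map (Z q)) := fun q =>
    Measure.isProbabilityMeasure_map (hZm q).aemeasurable
  have hvec : Measurable fun ω q => Z q ω := measurable_pi_iff.2 hZm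
  obtain ⟨A, hAm, hA, hAcard⟩ := exists_measurableSet_card_lt hQ (fun q => ν.map (Z q))
    (fun q => (integrable_map_measure (by fun_prop) (hZm q).aemeasurable).2
      (integrable_norm_linearCombination_sq hWm hW2 (T q) (a q)))
    hr hδ hη₀ hη
    (fun q f hf => by
      rw [integral_map (hZm q).aemeasurable (by fun_prop)]
      simp only [hZ]
      rw [integral_inner_linearCombination_sq hWm hWind hW2 f (fun i => hW0 i f)]
      simpa only [hWinner] using hvar q f hf)
    (by
      refine le_trans (le_of_eq (Finset.sum_congr rfl fun q _ => ?_)) htr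
      rw [integral_map (hZm q).aemeasurable (by fun_prop)]
      simp only [hZ]
      rw [integral_norm_linearCombination_sq hWm hWind hW2 hW0]
      simp only [hWnorm])
  rw [← hZind.map_fun_eq_pi_map fun q => (hZm q).aemeasurable, Measure.map_apply hvec hAm] at hA
  have hnull : ν {ω | ¬ ∀ i, U i ω = W i ω} = 0 := ae_iff.1 (ae_all_iff.2 hUW)
  refine ⟨(fun ω q => Z q ω) ⁻¹' A ∩ (toMeasurable ν {ω | ¬ ∀ i, U i ω = W i ω})ᶜ,
    (hvec hAm).inter (measurableSet_toMeasurable _ _).compl, ?_, ?_⟩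
  · rwa [measure_inter_conull (by rwa [compl_compl, measure_toMeasurable])]
  · rintro ω ⟨hω, hω'⟩ f hf
    have heq : ∀ i, U i ω = W i ω := by
      by_contra h
      exact hω' (subset_toMeasurable _ _ h)
    simp_rw [heq]
    exact hAcard _ hω f hf

end BlockEvent

/-! ### Block mean differences as linear combinations. -/

section Sample

variable {𝒳 : Type*} {H : Type*} [NormedAddCommGroup H] [InnerProductSpace ℝ H]
  [CompleteSpace H] [RKHS ℝ H 𝒳 ℝ]

/-- The weights of the difference of two empirical means over blocks of size `m`. -/
noncomputable def blockWeight {N : ℕ} (m : ℝ) : Fin N ⊕ Fin N → ℝ :=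
  Sum.elim (fun _ => m⁻¹) fun _ => -m⁻¹

lemma sum_blockWeight_sq_mul {N : ℕ} (S : Finset (Fin N)) (hS : S.Nonempty)
    {c : Fin N ⊕ Fin N → ℝ} {cP cR : ℝ} (hP : ∀ n, c (.inl n) = cP) (hR : ∀ n, c (.inr n) = cR) :
    ∑ i ∈ S.disjSum S, blockWeight (S.card : ℝ) i ^ 2 * c i = (S.card : ℝ)⁻¹ * (cP + cR) := by
  have : (S.card : ℝ) ≠ 0 := by exact_mod_cast hS.card_pos.ne'
  rw [Finset.sum_disjSum]
  simp [blockWeight, hP, hR]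
  field_simp

lemma blockMean_sub_blockMean_sub {N : ℕ} (S : Finset (Fin N)) (hS : S.Nonempty) (x y : Fin N → 𝒳)
    (μ μ' : H) :
    blockMean H x S - blockMean H y S - (μ - μ') = ∑ i ∈ S.disjSum S, blockWeight (S.card : ℝ) i •
      Sum.elim (fun n => feature H (x n) - μ) (fun n => feature H (y n) - μ') i := by
  have hS' : (S.card : ℝ) ≠ 0 := by exact_mod_cast hS.card_pos.ne'
  have h : ∀ v : H, (S.card : ℝ)⁻¹ • (S.card • v) = v := fun v => by
    rw [← Nat.cast_smul_eq_nsmul ℝ, smul_smul, inv_mul_cancel₀ hS', one_smul]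
  rw [Finset.sum_disjSum]
  simp only [blockWeight, blockMean, Sum.elim_inl, Sum.elim_inr, neg_smul, Finset.sum_neg_distrib]
  simp only [← Finset.smul_sum, Finset.sum_sub_distrib, Finset.sum_const, smul_sub, h]
  abel

lemma blockMean_congr {N : ℕ} {x x' : Fin N → 𝒳} {S : Finset (Fin N)}
    (h : ∀ n ∈ S, x n = x' n) : blockMean H x S = blockMean H x' S := by
  rw [blockMean, blockMean, Finset.sum_congr rfl fun n hn => by rw [h n hn]]

end Sample

end MONK

/-! ### The main theorem. -/

theorem theorem2
    {𝒳 : Type*} [TopologicalSpace 𝒳] [TopologicalSpace.SeparableSpace 𝒳]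
    [MeasurableSpace 𝒳] [BorelSpace 𝒳]
    -- a continuous kernel `K` on `𝒳` and its reproducing kernel Hilbert space `H`
    (K : 𝒳 → 𝒳 → ℝ) (hK : Continuous fun p : 𝒳 × 𝒳 => K p.1 p.2)
    {H : Type*} [NormedAddCommGroup H] [InnerProductSpace ℝ H] [CompleteSpace H]
    [RKHS ℝ H 𝒳 ℝ] (hKH : ∀ x y, MONK.kernelFn H x y = K x y)
    -- the two distributions, with covariance operators that exist and are trace-class
    (P R : Measure 𝒳) [IsProbabilityMeasure P] [IsProbabilityMeasure R]
    (hP : Integrable (fun x => K x x) P) (hR : Integrable (fun x => K x x) R)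
    (hPtr : MONK.IsTraceClass (MONK.covOp H P)) (hRtr : MONK.IsTraceClass (MONK.covOp H R))
    -- sample size, number of blocks, number of corrupted pairs, levels
    (N Q Nc : ℕ) (δ η : ℝ) (hδ₀ : 0 < δ) (hδ : δ ≤ 1 / 2) (hη₀ : 0 < η) (hη : η < 1)
    (hQ : (Q : ℝ) = 72 * Real.log (1 / η) / δ ^ 2)
    (hNc : (Nc : ℝ) ≤ Q * (1 / 2 - δ)) (hQN : (Q : ℝ) < N / 2) (hdvd : Q ∣ N)
    -- a partition of the indices into `Q` blocks of the same cardinality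
    (S : Fin Q → Finset (Fin N)) (hS : ∀ n, ∃! q, n ∈ S q) (hScard : ∀ q, (S q).card = N / Q)
    -- the clean samples: independent, `X n ∼ P` and `Y n ∼ R`
    {Ω : Type*} [MeasurableSpace Ω] (ν : Measure Ω) [IsProbabilityMeasure ν]
    (X Y : Fin N → Ω → 𝒳) (hX : ∀ n, HasLaw (X n) P ν) (hY : ∀ n, HasLaw (Y n) R ν)
    (hindep : iIndepFun (Sum.elim X Y) ν)
    -- the observed samples: at most `Nc` of the `N` pairs are arbitrarily corrupted
    (X' Y' : Fin N → Ω → 𝒳)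
    (hcorr : ∀ ω, {n | ¬ (X' n ω = X n ω ∧ Y' n ω = Y n ω)}.ncard ≤ Nc) :
    ∃ E : Set Ω, MeasurableSet E ∧ ENNReal.ofReal (1 - η) ≤ ν E ∧ ∀ ω ∈ E,
      |MONK.mmdEstimator H S (fun n => X' n ω) (fun n => Y' n ω) - MONK.MMD H P R| ≤
        12 * max
          (√((‖MONK.covOp H P‖ + ‖MONK.covOp H R‖) * Real.log (1 / η) / (δ * N)))
          (2 * √((MONK.trace (MONK.covOp H P) + MONK.trace (MONK.covOp H R)) / N)) / δ := by
  classical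
  let mH : MeasurableSpace H := borel H
  have hBorel : BorelSpace H := ⟨rfl⟩
  have hker : MONK.kernelFn H = K := funext fun x => funext fun y => hKH x y
  have hfc : Continuous (MONK.feature H : 𝒳 → H) := MONK.continuous_feature (by rw [hker]; exact hK)
  have hfm : Measurable (MONK.feature H : 𝒳 → H) := hfc.measurable
  have hsc : SecondCountableTopology H := MONK.secondCountableTopology_of_continuous_feature hfc
  have hP' : Integrable (fun x => MONK.kernelFn H x x) P := by rw [hker]; exact hP
  have hR' : Integrable (fun x => MONK.kernelFn H x x) R := by rw [hker]; exact hR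
  set μP := MONK.meanEmbedding H P with hμP
  set μR := MONK.meanEmbedding H R with hμR
  set l := Real.log (1 / η) with hl
  set s := ‖MONK.covOp H P‖ + ‖MONK.covOp H R‖ with hs
  set τ := MONK.trace (MONK.covOp H P) + MONK.trace (MONK.covOp H R) with hτ
  set r := 12 * max (√(s * l / (δ * N))) (2 * √(τ / N)) / δ with hr
  have hl0 : 0 < l := Real.log_pos (by rw [lt_div_iff₀ hη₀]; linarith)
  have hQ0' : (0 : ℝ) < Q := by rw [hQ]; positivity
  have hQ0 : 0 < Q := by exact_mod_cast hQ0'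
  have hN0' : (0 : ℝ) < N := by linarith
  have hN0 : 0 < N := by exact_mod_cast hN0'
  have hlQ : l = Q * δ ^ 2 / 72 := by rw [hQ]; field_simp
  have hs0 : 0 ≤ s := by positivity
  have hτ0 : 0 ≤ τ := by
    rw [hτ, MONK.trace_covOp hfm hP', MONK.trace_covOp hfm hR']
    exact add_nonneg (integral_nonneg fun x => sq_nonneg _) (integral_nonneg fun x => sq_nonneg _)
  have hr0 : 0 ≤ r := by positivity
  -- The two arguments of the maximum are used separately: `hr1` controls the variance along a
  -- direction, `hr2` the sum of the second moments.
  have hr1 : 144 * (s * l / (δ * N)) / δ ^ 2 ≤ r ^ 2 := by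
    have h1 : 12 * √(s * l / (δ * N)) / δ ≤ r := by rw [hr]; gcongr; exact le_max_left _ _
    have h2 := pow_le_pow_left₀ (by positivity) h1 2
    rw [div_pow, mul_pow, Real.sq_sqrt (by positivity)] at h2
    norm_num at h2 ⊢
    exact h2
  have hr2 : 576 * (τ / N) / δ ^ 2 ≤ r ^ 2 := by
    have h1 : 12 * (2 * √(τ / N)) / δ ≤ r := by rw [hr]; gcongr; exact le_max_right _ _
    have h2 := pow_le_pow_left₀ (by positivity) h1 2
    rw [div_pow, mul_pow, mul_pow, Real.sq_sqrt (by positivity)] at h2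
    calc _ = 12 ^ 2 * (2 ^ 2 * (τ / N)) / δ ^ 2 := by ring
      _ ≤ _ := h2
  have hcard : ∀ q, ((S q).card : ℝ) = N / Q := fun q => by
    rw [hScard q, Nat.cast_div hdvd hQ0'.ne']
  have hSne : ∀ q, (S q).Nonempty := fun q => by
    rw [← Finset.card_pos, hScard q]
    exact Nat.div_pos (Nat.le_of_dvd hN0 hdvd) hQ0
  have hcinv : ∀ q, ((S q).card : ℝ)⁻¹ = Q / N := fun q => by rw [hcard q, inv_div]
  -- Both samples form one centered independent family; block `q` uses the indices of `S q` in both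
  -- summands, with weights of opposite sign.
  set U : Fin N ⊕ Fin N → Ω → H := fun i ω =>
    Sum.elim (fun n => MONK.feature H (X n ω) - μP) (fun n => MONK.feature H (Y n ω) - μR) i with hU
  have hUint : ∀ (g : H → ℝ), Measurable g →
      (∀ n, ∫ ω, g (U (.inl n) ω) ∂ν = ∫ x, g (MONK.feature H x - μP) ∂P) ∧
      (∀ n, ∫ ω, g (U (.inr n) ω) ∂ν = ∫ x, g (MONK.feature H x - μR) ∂(R)) := fun g hg =>
    ⟨fun n => (hX n).integral_comp (f := fun x => g (MONK.feature H x - μP))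
        (hg.comp (hfm.sub_const _)).aestronglyMeasurable,
      fun n => (hY n).integral_comp (f := fun x => g (MONK.feature H x - μR))
        (hg.comp (hfm.sub_const _)).aestronglyMeasurable⟩
  have hUm : ∀ i, AEMeasurable (U i) ν := by
    rintro (n | n)
    · exact (hfm.sub_const _).comp_aemeasurable (hX n).aemeasurable
    · exact (hfm.sub_const _).comp_aemeasurable (hY n).aemeasurable
  have hUind : iIndepFun U ν := by
    have := hindep.comp (fun i x => MONK.feature H x - Sum.elim (fun _ => μP) (fun _ => μR) i)
      fun i => hfm.sub_const _
    convert this using 2 with i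
    rcases i with n | n <;> rfl
  have hU2 : ∀ i, Integrable (fun ω => ‖U i ω‖ ^ 2) ν := by
    have hX2 := MONK.integrable_norm_centered_feature_sq hfm hP'
    have hY2 := MONK.integrable_norm_centered_feature_sq hfm hR'
    rintro (n | n)
    · have hm : AEStronglyMeasurable (fun x => ‖MONK.feature H x - μP‖ ^ 2) (ν.map (X n)) := by
        rw [(hX n).map_eq]
        exact hX2.1
      refine (integrable_map_measure hm (hX n).aemeasurable).1 ?_
      rwa [(hX n).map_eq]
    · have hm : AEStronglyMeasurable (fun x => ‖MONK.feature H x - μR‖ ^ 2) (ν.map (Y n)) := by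
        rw [(hY n).map_eq]
        exact hY2.1
      refine (integrable_map_measure hm (hY n).aemeasurable).1 ?_
      rwa [(hY n).map_eq]
  have hU0 : ∀ i, ∀ f, ∫ ω, ⟪f, U i ω⟫_ℝ ∂ν = 0 := by
    intro i f
    have h := hUint (fun v => ⟪f, v⟫_ℝ) (by fun_prop)
    rcases i with n | n
    · exact (h.1 n).trans (MONK.integral_inner_centered_feature hfm hP' f)
    · exact (h.2 n).trans (MONK.integral_inner_centered_feature hfm hR' f)
  have hTdisj : ∀ q q', q ≠ q' → Disjoint ((S q).disjSum (S q)) ((S q').disjSum (S q')) := by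
    intro q q' hqq
    have hd : ∀ n, n ∈ S q → n ∈ S q' → False := fun n h h' => hqq ((hS n).unique h h')
    refine Finset.disjoint_left.2 ?_
    rintro (n | n) h h'
    · exact hd n (Finset.inl_mem_disjSum.1 h) (Finset.inl_mem_disjSum.1 h')
    · exact hd n (Finset.inr_mem_disjSum.1 h) (Finset.inr_mem_disjSum.1 h')
  obtain ⟨E, hEm, hE, hEcard⟩ := MONK.exists_event_card_lt hUm hUind hU2 hU0 hQ0
    (fun q => (S q).disjSum (S q)) hTdisj (fun q => MONK.blockWeight ((S q).card : ℝ))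
    (r := r) (δ := δ) (η := η) hr0 hδ₀ hη₀
    (by
      rw [← hlQ, hl, ← Real.log_inv, one_div, inv_inv, Real.exp_log hη₀])
    (fun q f hf => by
      have h := hUint (fun v => ⟪f, v⟫_ℝ ^ 2) (by fun_prop)
      rw [MONK.sum_blockWeight_sq_mul (S q) (hSne q) h.1 h.2, hcinv]
      have h1 := MONK.integral_inner_centered_feature_sq_le hfm hP' hf
      have h2 := MONK.integral_inner_centered_feature_sq_le hfm hR' hf
      calc _ ≤ (Q : ℝ) / N * s := mul_le_mul_of_nonneg_left (add_le_add h1 h2) (by positivity)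
        _ = 144 * (s * l / (δ * N)) / δ ^ 2 * (δ / 2) := by
            rw [hlQ]
            field_simp
            ring
        _ ≤ _ := mul_le_mul_of_nonneg_right hr1 (by positivity))
    (by
      have h := hUint (fun v => ‖v‖ ^ 2) (by fun_prop)
      calc _ = ∑ q : Fin Q, (Q : ℝ) / N * τ := Finset.sum_congr rfl fun q _ => by
            rw [MONK.sum_blockWeight_sq_mul (S q) (hSne q) h.1 h.2, hcinv, hτ,
              MONK.trace_covOp hfm hP', MONK.trace_covOp hfm hR']
        _ = 576 * (τ / N) / δ ^ 2 * (Q * δ / 24) ^ 2 := by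
            simp
            field_simp
            ring
        _ ≤ r ^ 2 * (Q * δ / 24) ^ 2 := mul_le_mul_of_nonneg_right hr2 (sq_nonneg _)
        _ = _ := by ring)
  refine ⟨E, hEm, hE, fun ω hω => ?_⟩
  refine MONK.abs_iSup_median_sub_norm_le hQ0 _ (μP - μR) fun f hf => ?_
  set C : Finset (Fin N) := Finset.univ.filter fun n => ¬ (X' n ω = X n ω ∧ Y' n ω = Y n ω) with hC
  have hCcard : C.card ≤ Nc := by
    rw [← Set.ncard_coe_finset]
    simpa [hC] using hcorr ω
  have hbad := (MONK.card_blocks_meeting_le S hS C).trans hCcard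
  have hgood := hEcard ω hω f hf
  have hsub : (Finset.univ.filter fun q => r < ⟪f, MONK.blockMean H (fun n => X' n ω) (S q) -
        MONK.blockMean H (fun n => Y' n ω) (S q) - (μP - μR)⟫_ℝ) ⊆
      (Finset.univ.filter fun q => r < ⟪f, ∑ i ∈ (S q).disjSum (S q),
        MONK.blockWeight ((S q).card : ℝ) i • U i ω⟫_ℝ) ∪
      Finset.univ.filter fun q => ∃ n ∈ S q, n ∈ C := by
    intro q hq
    by_cases hqC : ∃ n ∈ S q, n ∈ C
    · exact Finset.mem_union_right _ (by simpa using hqC)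
    · refine Finset.mem_union_left _ ?_
      have hclean : ∀ n ∈ S q, X' n ω = X n ω ∧ Y' n ω = Y n ω := fun n hn => by
        by_contra h
        exact hqC ⟨n, hn, by simpa [hC] using h⟩
      simp only [Finset.mem_filter, Finset.mem_univ, true_and] at hq ⊢
      rwa [MONK.blockMean_congr (x' := fun n => X n ω) fun n hn => (hclean n hn).1,
        MONK.blockMean_congr (x := fun n => Y' n ω) (x' := fun n => Y n ω)
          fun n hn => (hclean n hn).2,
        MONK.blockMean_sub_blockMean_sub _ (hSne q)] at hq
  have hle := (Finset.card_le_card hsub).trans (Finset.card_union_le _ _)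
  have hle' : ((Finset.univ.filter fun q => r < ⟪f, MONK.blockMean H (fun n => X' n ω) (S q) -
      MONK.blockMean H (fun n => Y' n ω) (S q) - (μP - μR)⟫_ℝ).card : ℝ) < Q / 2 := by
    have h1 : ((Finset.univ.filter fun q => r < ⟪f, MONK.blockMean H (fun n => X' n ω) (S q) -
        MONK.blockMean H (fun n => Y' n ω) (S q) - (μP - μR)⟫_ℝ).card : ℝ) ≤ _ :=
      Nat.cast_le.2 hle
    have h2 : ((Finset.univ.filter fun q => ∃ n ∈ S q, n ∈ C).card : ℝ) ≤ Nc := Nat.cast_le.2 hbad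
    -- The clean deviating blocks number fewer than `δ * Q` and the corrupted ones at most `Q * (1/2
    -- - δ)`, which add up to less than `Q / 2`.
    push_cast at h1
    linarith
  have h2 : ((2 * (Finset.univ.filter fun q => r < ⟪f, MONK.blockMean H (fun n => X' n ω) (S q) -
      MONK.blockMean H (fun n => Y' n ω) (S q) - (μP - μR)⟫_ℝ).card : ℕ) : ℝ) < Q := by
    push_cast
    linarith
  exact_mod_cast h2
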